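/- **Setting.** For each sample size $n$ let $d=d_n$ be a dimension (arbitrary in $n$), write $\tau_t=t/n$, and let $(X_t)$ be a $d$-dimensional time-varying VAR(1) process $$X_t=\mathbf A(\tau_t)X_{t-1}+e_t,\qquad e_t=\boldsymbol\Sigma(\tau_t)^{1/2}\varepsilon_t,\qquad t=1,\dots,n,$$ where $(\varepsilon_t)_{t\in\mathbb Z}$ are i.i.d. $d$-dimensional vectors with mean zero and identity covariance, and $X_t=\sum_{k\ge 0}\boldsymbol\Phi_{t,k}e_{t-k}$ almost surely for $0\le t\le n$, with $\boldsymbol\Phi_{t,0}=\mathbf I_d$ and $\boldsymbol\Phi_{t,k}=\mathbf A(\tau_t)\mathbf A(\tau_{t-1})\cdots\mathbf A(\tau_{t-k+1})$. (Everything may depend on $n$; $\mathbf A,\boldsymbol\Sigma$ are defined on $(-\infty,1]$, the values at negative arguments only describing the infinite past.) Let $\boldsymbol\alpha_{i\bullet}(\tau)=(\alpha_{i,1}(\tau),\dots,\alpha_{i,d}(\tau))^\top$ be the $i$-th row of $\mathbf A(\tau)$ and $\boldsymbol\alpha'_{i\bullet}$ its derivative on $[0,1]$; put $\mathcal J_i(\tau)=\{j:\alpha_{i,j}(\tau)\ne0\}$,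 $\mathcal J'_i(\tau)=\{j:\alpha'_{i,j}(\tau)\neq0\}$ and $s=\max_{1\le i\le d}|\bigcup_{t=1}^n\mathcal J_i(\tau_t)|$, where $s\ge1$ for all large $n$. $\|\cdot\|$ is the Euclidean norm or the operator norm it induces, $|\cdot|_1$ is the $\ell_1$ norm. For a kernel $K$, $K_h(x)=h^{-1}K(x/h)$, bandwidth $h>0$ and tuning parameter $\lambda_1>0$, the preliminary time-varying LASSO estimates $(\widetilde{\boldsymbol\alpha}_{i\bullet}(\tau),\widetilde{\boldsymbol\alpha}'_{i\bullet}(\tau))$ are any minimisers over $(\boldsymbol\alpha,\boldsymbol\beta)\in\mathbb R^d\times\mathbb R^d$ of $$\frac1n\sum_{t=1}^n\bigl\{x_{t,i}-[\boldsymbol\alpha+\boldsymbol\beta(\tau_t-\tau)]^\top X_{t-1}\bigr\}^2K_h(\tau_t-\tau)+\lambda_1\bigl(|\boldsymbol\alpha|_1+h|\boldsymbol\beta|_1\bigr).$$ **Assumption 1.** With constants $C_0,C_1,C_\Sigma,D$, $\iota_1>0$, $\rho\in(0,1)$ not depending on $n$: $\det(\mathbf I_d-\mathbf A(\tau)z)\neq0$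 for all $\tau\in[0,1]$ and complex $|z|\le1$; $\|\boldsymbol\Phi_{t,k}\|\le C_1\rho^k$ for all $0\le t\le n$, $k\ge0$; every $\alpha_{i,j}$ is twice continuously differentiable on $[0,1]$ with $|\alpha''_{i,j}|\le D$; $\boldsymbol\Sigma(\tau)$ is positive definite on $[0,1]$, positive semidefinite for $\tau<0$, with $\|\boldsymbol\Sigma(\tau)\|\le C_\Sigma$ for $\tau\le 1$, and the entries of $\boldsymbol\Sigma$ and $\boldsymbol\Sigma^{-1}$ are twice continuously differentiable on $[0,1]$; $\mathsf E\exp\{\iota_1(u^\top\varepsilon_t)^2\}\le C_0$ for all $t$ and all $u\in\mathbb R^d$ with $\|u\|=1$. **Assumption 2.** $K$ is a bounded symmetric probability density vanishing outside $[-1,1]$ and continuous on $[-1,1]$; $nh/\log^2(n\vee d)\to\infty$ and $sh^2\log(n\vee d)\to0$. **Assumption 3.** (i) $\zeta_{n,d}:=\log(n\vee d)\,[(nh)^{-1/2}+sh^2]=o(\lambda_1)$ and $\sqrt s\,\lambda_1/h\to0$. (ii) There is a constant $\kappa_0>0$ such that, with probability approaching one, $$\min_{1\le i\le d}\ \min_{1\le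 t\le n}\ \inf_{u\in\mathcal B_i(\tau_t)}u^\top\boldsymbol\Psi(\tau_t)u\ge\kappa_0 ,$$ where $$\boldsymbol\Psi=\begin{pmatrix}\boldsymbol\Psi_0&\boldsymbol\Psi_1\\ \boldsymbol\Psi_1&\boldsymbol\Psi_2\end{pmatrix},\qquad \boldsymbol\Psi_k(\tau)=\frac1n\sum_{t=1}^n\Bigl(\frac{\tau_t-\tau}h\Bigr)^kX_{t-1}X_{t-1}^\top K_h(\tau_t-\tau),$$ and $\mathcal B_i(\tau)$ is the set of $u=(u_1^\top,u_2^\top)^\top\in\mathbb R^{2d}$ with $\|u_1\|^2+\|u_2\|^2=1$ and $|u_1|_1+|u_2|_1\le3\bigl(\sum_{j\in\mathcal J_i(\tau)}|u_{1,j}|+\sum_{j\in\mathcal J'_i(\tau)}|u_{2,j}|\bigr)$. **Theorem 4.1.** Under Assumptions 1–3, as $n\to\infty$, $$\max_{1\le i\le d}\max_{1\le t\le n}\bigl\|\widetilde{\boldsymbol\alpha}_{i\bullet}(\tau_t)-\boldsymbol\alpha_{i\bullet}(\tau_t)\bigr\|=O_P(\sqrt s\,\lambda_1),$$ and moreover $$\max_{1\le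 i\le d}\max_{1\le t\le n}\Bigl(\bigl\|\widetilde{\boldsymbol\alpha}_{i\bullet}(\tau_t)-\boldsymbol\alpha_{i\bullet}(\tau_t)\bigr\|+h\bigl\|\widetilde{\boldsymbol\alpha}'_{i\bullet}(\tau_t)-\boldsymbol\alpha'_{i\bullet}(\tau_t)\bigr\|\Bigr)=O_P(\sqrt s\,\lambda_1),$$ where $\sqrt s\,\lambda_1\to0$, so that the estimates of the rows of $\mathbf A$ are uniformly consistent. -/

import Mathlib

open MeasureTheory ProbabilityTheory Filter Topology Asymptotics
open scoped MatrixOrder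

noncomputable section

namespace TVVAR

/-- The scaled time point `τ_t = t / n`. -/
def scaledTime (n : ℕ) (t : ℤ) : ℝ := (t : ℝ) / (n : ℝ)

/-- The operator norm of a matrix induced by the Euclidean norm. -/
def opNorm {d : ℕ} (W : Matrix (Fin d) (Fin d) ℝ) : ℝ :=
  ‖Matrix.toEuclideanCLM (n := Fin d) (𝕜 := ℝ) W‖

/-- The Euclidean norm of a vector. -/
def l2Norm {d : ℕ} (v : Fin d → ℝ) : ℝ := ‖WithLp.toLp 2 v‖

/-- The coefficient matrices of the moving average representation,
`Φ_{t,0} = I` and `Φ_{t,k} = A(τ_t) A(τ_{t-1}) ⋯ A(τ_{t-k+1})`. -/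
def wold (n : ℕ) {d : ℕ} (A : ℝ → Matrix (Fin d) (Fin d) ℝ) (t : ℤ) :
    ℕ → Matrix (Fin d) (Fin d) ℝ
  | 0 => 1
  | k + 1 => wold n A t k * A (scaledTime n (t - k))

/-- The innovation `e_t = Σ(τ_t)^{1/2} ε_t`, with the positive semidefinite square root. -/
def innovation {Ω : Type*} (n : ℕ) {d : ℕ} (Sig : ℝ → Matrix (Fin d) (Fin d) ℝ)
    (ε : ℤ → Ω → Fin d → ℝ) (t : ℤ) (ω : Ω) : Fin d → ℝ :=
  Matrix.mulVec (CFC.sqrt (Sig (scaledTime n t))) (ε t ω)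

/-- `(X_t)` is generated by the time-varying VAR(1) model with sample size `n`, transition
matrix function `A`, volatility matrix function `Sig` and noise `ε`.  The values of `A` and `Sig`
at negative scaled times only describe the infinite past that enters the moving average
representation. -/
structure IsModel {Ω : Type*} [MeasurableSpace Ω] (P : Measure Ω) (n : ℕ) {d : ℕ}
    (A Sig : ℝ → Matrix (Fin d) (Fin d) ℝ) (ε X : ℤ → Ω → Fin d → ℝ) : Prop where
  measurable_noise : ∀ t, Measurable (ε t)
  indep_noise : iIndepFun ε P
  identDistrib_noise : ∀ t t', IdentDistrib (ε t) (ε t') P P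
  noise_mean : ∀ t i, ∫ ω, ε t ω i ∂P = 0
  noise_cov : ∀ t i j, ∫ ω, ε t ω i * ε t ω j ∂P = (1 : Matrix (Fin d) (Fin d) ℝ) i j
  measurable_state : ∀ t, Measurable (X t)
  recursion : ∀ t : ℤ, 1 ≤ t → t ≤ n → ∀ᵐ ω ∂P,
    X t ω = Matrix.mulVec (A (scaledTime n t)) (X (t - 1) ω) + innovation n Sig ε t ω
  moving_average : ∀ t : ℤ, 0 ≤ t → t ≤ n → ∀ᵐ ω ∂P,
    HasSum (fun k : ℕ => Matrix.mulVec (wold n A t k) (innovation n Sig ε (t - k) ω)) (X t ω)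

/-- The structural conditions on the model: stability, geometric decay of the moving average
coefficients, smoothness, a positive definite bounded volatility matrix and sub-Gaussian noise.
The constants are to be chosen independently of the sample size. -/
structure ModelConditions {Ω : Type*} [MeasurableSpace Ω] (P : Measure Ω) (n : ℕ) {d : ℕ}
    (A Sig : ℝ → Matrix (Fin d) (Fin d) ℝ) (ε : ℤ → Ω → Fin d → ℝ)
    (C₁ ρ D Cσ ι₁ C₀ : ℝ) : Prop where
  stable : ∀ τ ∈ Set.Icc (0 : ℝ) 1, ∀ z : ℂ, ‖z‖ ≤ 1 →
    Matrix.det (1 - z • (A τ).map (fun x : ℝ => (x : ℂ))) ≠ 0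
  wold_decay : ∀ t : ℤ, 0 ≤ t → t ≤ n → ∀ k : ℕ, opNorm (wold n A t k) ≤ C₁ * ρ ^ k
  smooth_transition : ∀ i j, ContDiffOn ℝ 2 (fun τ => A τ i j) (Set.Icc 0 1)
  second_deriv_bound : ∀ i j, ∀ τ ∈ Set.Icc (0 : ℝ) 1,
    |iteratedDerivWithin 2 (fun τ => A τ i j) (Set.Icc 0 1) τ| ≤ D
  volatility_posDef : ∀ τ ∈ Set.Icc (0 : ℝ) 1, (Sig τ).PosDef
  volatility_posSemidef : ∀ τ < (0 : ℝ), (Sig τ).PosSemidef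
  volatility_bound : ∀ τ ≤ (1 : ℝ), opNorm (Sig τ) ≤ Cσ
  smooth_volatility : ∀ i j, ContDiffOn ℝ 2 (fun τ => Sig τ i j) (Set.Icc 0 1)
  smooth_precision : ∀ i j, ContDiffOn ℝ 2 (fun τ => (Sig τ)⁻¹ i j) (Set.Icc 0 1)
  subGaussian : ∀ t, ∀ u : Fin d → ℝ, l2Norm u = 1 →
    ∫⁻ ω, ENNReal.ofReal (Real.exp (ι₁ * (u ⬝ᵥ ε t ω) ^ 2)) ∂P ≤ ENNReal.ofReal C₀

/-- A bounded symmetric probability density with support in `[-1, 1]`, continuous there. -/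
structure IsKernel (K : ℝ → ℝ) : Prop where
  nonneg : ∀ x, 0 ≤ K x
  integral_eq_one : ∫ x, K x = 1
  bounded : ∃ B, ∀ x, K x ≤ B
  continuousOn : ContinuousOn K (Set.Icc (-1) 1)
  symmetric : ∀ x, K (-x) = K x
  support : ∀ x, 1 < |x| → K x = 0

/-- `K_h(x) = K(x / h) / h`. -/
def scaledKernel (K : ℝ → ℝ) (h x : ℝ) : ℝ := h⁻¹ * K (x / h)

/-- The `i`-th row `α_{i•}(τ)` of the transition matrix. -/
def coef {d : ℕ} (A : ℝ → Matrix (Fin d) (Fin d) ℝ) (i : Fin d) (τ : ℝ) : Fin d → ℝ :=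
  fun j => A τ i j

/-- The vector `α'_{i•}(τ)` of derivatives on `[0, 1]`, one-sided at the end points. -/
def coefDeriv {d : ℕ} (A : ℝ → Matrix (Fin d) (Fin d) ℝ) (i : Fin d) (τ : ℝ) : Fin d → ℝ :=
  fun j => derivWithin (fun τ' => A τ' i j) (Set.Icc 0 1) τ

open Classical in
/-- `J_i(τ) = {j : α_{i,j}(τ) ≠ 0}`. -/
def activeSet {d : ℕ} (A : ℝ → Matrix (Fin d) (Fin d) ℝ) (i : Fin d) (τ : ℝ) :
    Finset (Fin d) :=
  Finset.univ.filter fun j => coef A i τ j ≠ 0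

open Classical in
/-- `J'_i(τ) = {j : α'_{i,j}(τ) ≠ 0}`. -/
def activeDerivSet {d : ℕ} (A : ℝ → Matrix (Fin d) (Fin d) ℝ) (i : Fin d) (τ : ℝ) :
    Finset (Fin d) :=
  Finset.univ.filter fun j => coefDeriv A i τ j ≠ 0

/-- `s = max_i |⋃_{1 ≤ t ≤ n} J_i(τ_t)|`. -/
def sparsity (n : ℕ) {d : ℕ} (A : ℝ → Matrix (Fin d) (Fin d) ℝ) : ℕ :=
  Finset.univ.sup fun i : Fin d =>
    ((Finset.Icc 1 n).biUnion fun t : ℕ => activeSet A i (scaledTime n t)).card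

/-- The local linear objective `L_i(α, β | τ)` computed from the path `x = (X_0, …, X_n)`. -/
def localLoss (n : ℕ) {d : ℕ} (K : ℝ → ℝ) (h : ℝ) (x : ℤ → Fin d → ℝ) (i : Fin d) (τ : ℝ)
    (α β : Fin d → ℝ) : ℝ :=
  (1 / (n : ℝ)) * ∑ t ∈ Finset.Icc 1 n,
    (x t i - (α + (scaledTime n t - τ) • β) ⬝ᵥ x ((t : ℤ) - 1)) ^ 2 *
      scaledKernel K h (scaledTime n t - τ)

/-- The LASSO objective `L_i^*(α, β | τ) = L_i(α, β | τ) + λ₁ (|α|₁ + h |β|₁)`. -/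
def lassoLoss (n : ℕ) {d : ℕ} (K : ℝ → ℝ) (h lam : ℝ) (x : ℤ → Fin d → ℝ) (i : Fin d) (τ : ℝ)
    (α β : Fin d → ℝ) : ℝ :=
  localLoss n K h x i τ α β + lam * (∑ j, |α j| + h * ∑ j, |β j|)

/-- `(α, β)` minimises the LASSO objective at `τ`: it is a preliminary time-varying LASSO
estimate of `(α_{i•}(τ), α'_{i•}(τ))`. -/
def IsLassoEstimate (n : ℕ) {d : ℕ} (K : ℝ → ℝ) (h lam : ℝ) (x : ℤ → Fin d → ℝ) (i : Fin d)
    (τ : ℝ) (α β : Fin d → ℝ) : Prop :=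
  ∀ α' β' : Fin d → ℝ, lassoLoss n K h lam x i τ α β ≤ lassoLoss n K h lam x i τ α' β'

/-- `Ψ_k(τ) = n⁻¹ ∑_t ((τ_t - τ) / h)^k X_{t-1} X_{t-1}ᵀ K_h(τ_t - τ)`. -/
def psi (n : ℕ) {d : ℕ} (K : ℝ → ℝ) (h : ℝ) (x : ℤ → Fin d → ℝ) (τ : ℝ) (k : ℕ) :
    Matrix (Fin d) (Fin d) ℝ :=
  (1 / (n : ℝ)) • ∑ t ∈ Finset.Icc 1 n,
    (((scaledTime n t - τ) / h) ^ k * scaledKernel K h (scaledTime n t - τ)) •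
      Matrix.vecMulVec (x ((t : ℤ) - 1)) (x ((t : ℤ) - 1))

/-- The block matrix `Ψ(τ)` with blocks `Ψ₀, Ψ₁, Ψ₁, Ψ₂`. -/
def psiBlock (n : ℕ) {d : ℕ} (K : ℝ → ℝ) (h : ℝ) (x : ℤ → Fin d → ℝ) (τ : ℝ) :
    Matrix (Fin d ⊕ Fin d) (Fin d ⊕ Fin d) ℝ :=
  Matrix.fromBlocks (psi n K h x τ 0) (psi n K h x τ 1) (psi n K h x τ 1) (psi n K h x τ 2)

/-- The set `B_i(τ)` of the restricted eigenvalue condition; `u = (u₁, u₂)`. -/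
def restrictedSet {d : ℕ} (A : ℝ → Matrix (Fin d) (Fin d) ℝ) (i : Fin d) (τ : ℝ) :
    Set (Fin d ⊕ Fin d → ℝ) :=
  {u | ∑ j, u (Sum.inl j) ^ 2 + ∑ j, u (Sum.inr j) ^ 2 = 1 ∧
    ∑ j, (|u (Sum.inl j)| + |u (Sum.inr j)|) ≤
      3 * (∑ j ∈ activeSet A i τ, |u (Sum.inl j)| + ∑ j ∈ activeDerivSet A i τ, |u (Sum.inr j)|)}

/-- The inequality `min_i min_t inf_{u ∈ B_i(τ_t)} uᵀ Ψ(τ_t) u ≥ κ₀` for the path `x`. -/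
def RestrictedEigenvalue (n : ℕ) {d : ℕ} (A : ℝ → Matrix (Fin d) (Fin d) ℝ) (K : ℝ → ℝ)
    (h κ₀ : ℝ) (x : ℤ → Fin d → ℝ) : Prop :=
  ∀ i : Fin d, ∀ t ∈ Finset.Icc 1 n, ∀ u ∈ restrictedSet A i (scaledTime n t),
    κ₀ ≤ u ⬝ᵥ Matrix.mulVec (psiBlock n K h x (scaledTime n t)) u

/-- `log(n ∨ d)`. -/
def logMax (n d : ℕ) : ℝ := Real.log (max (n : ℝ) (d : ℝ))

/-- `ζ_{n,d} = log(n ∨ d) ((n h)^{-1/2} + s h²)`. -/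
def zeta (n d s : ℕ) (h : ℝ) : ℝ :=
  logMax n d * ((Real.sqrt (n * h))⁻¹ + s * h ^ 2)

/-- `Y_n = O_P(r_n)` as `n → ∞`. -/
def IsBigOP {Ω : Type*} [MeasurableSpace Ω] (P : Measure Ω) (Y : ℕ → Ω → ℝ) (r : ℕ → ℝ) :
    Prop :=
  ∀ η : ℝ, 0 < η → ∃ M : ℝ, ∃ N : ℕ, ∀ n ≥ N,
    P {ω | M * r n < |Y n ω|} ≤ ENNReal.ofReal η

end TVVAR

end

/-! Substituting `h • β` for `β` turns the local linear problem into an ordinary weighted LASSO in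
2d variables with regressor (X_{t-1}, ((τ_t-τ)/h) X_{t-1}), whose Gram form is uᵀΨ(τ)u. If every
coordinate of the score at the true parameter is at most λ₁/8, optimality puts the error in the cone
of the restricted eigenvalue condition, and the quadratic form then controls its ℓ² norm
(`lasso_l2_bound`).

One difficulty is deterministic. The cone uses the exact supports, and the derivative support need
not lie in the union of the supports of the row over the grid: a coefficient can vanish at every
grid point and still have a nonzero slope there. Such slopes are at most D/n, by Taylor expansion to
a neighbouring grid point. The restricted eigenvalue condition itself limits their number: with more
active derivatives than observations in the window, a nonzero cone vector would be annihilated by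
the design (`card_activeDerivSet_le`). Their ℓ¹ mass is therefore O(h). Both the Taylor bias and the
part of the penalty lying off the grid support are then of the right order, and only 2s coordinates
enter the rate (`lasso_path_bound`).

The random part is the score, a sum of w_t X_{t-1,j} e_{t,i}. The moving average makes the states
sub-Gaussian, so all of them are bounded by b of order √log(n ∨ d) with high probability. After
truncation at b the regressors are predictable and bounded, and conditioning one step at a time
gives a sub-Gaussian tail for the sum (`lintegral_exp_predictable_sum_le`). A union bound over
times, rows and columns yields a score of order log(n ∨ d)(nh)^{-1/2}; the bias has order b² s h²,
that is log(n ∨ d) s h². Together they form ζ = o(λ₁), so the λ₁/8 condition holds eventually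
(`measure_not_goodPath_le`, `GoodPath.estimate_le`). -/

namespace TVVAR

/-! ### The LASSO with weighted squared loss -/

section Lasso

variable {ι T : Type*} [Fintype ι]

/-- Expanding the square around θ leaves a cross term equal to twice the pairing of the error with
the score; Hölder's inequality bounds it by λ/4 times the ℓ¹ error. -/
theorem lasso_basic_inequality (s : Finset T) (c y : T → ℝ) (z : T → ι → ℝ) (lam : ℝ)
    (θ θ' : ι → ℝ)
    (hmin : ∑ t ∈ s, c t * (y t - θ' ⬝ᵥ z t) ^ 2 + lam * ∑ j, |θ' j| ≤
      ∑ t ∈ s, c t * (y t - θ ⬝ᵥ z t) ^ 2 + lam * ∑ j, |θ j|)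
    (hscore : ∀ j, |∑ t ∈ s, c t * (y t - θ ⬝ᵥ z t) * z t j| ≤ lam / 8) :
    ∑ t ∈ s, c t * ((θ' - θ) ⬝ᵥ z t) ^ 2 ≤
      lam / 4 * ∑ j, |(θ' - θ) j| + lam * ∑ j, (|θ j| - |θ' j|) := by
  have hcross : ∑ t ∈ s, c t * (y t - θ ⬝ᵥ z t) * ((θ' - θ) ⬝ᵥ z t) =
      ∑ j, (θ' - θ) j * ∑ t ∈ s, c t * (y t - θ ⬝ᵥ z t) * z t j := by
    simp only [Finset.mul_sum]
    rw [Finset.sum_comm]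
    refine Finset.sum_congr rfl fun t _ => ?_
    generalize y t - θ ⬝ᵥ z t = r
    rw [dotProduct, Finset.mul_sum]
    exact Finset.sum_congr rfl fun j _ => by ring
  have hexp : ∑ t ∈ s, c t * (y t - θ' ⬝ᵥ z t) ^ 2 =
      ∑ t ∈ s, c t * (y t - θ ⬝ᵥ z t) ^ 2
        - 2 * ∑ t ∈ s, c t * (y t - θ ⬝ᵥ z t) * ((θ' - θ) ⬝ᵥ z t)
        + ∑ t ∈ s, c t * ((θ' - θ) ⬝ᵥ z t) ^ 2 := by
    rw [Finset.mul_sum, ← Finset.sum_sub_distrib, ← Finset.sum_add_distrib]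
    refine Finset.sum_congr rfl fun t _ => ?_
    rw [sub_dotProduct]
    ring
  have hbound : ∑ j, (θ' - θ) j * ∑ t ∈ s, c t * (y t - θ ⬝ᵥ z t) * z t j ≤
      lam / 8 * ∑ j, |(θ' - θ) j| := by
    rw [Finset.mul_sum]
    refine Finset.sum_le_sum fun j _ => ?_
    calc _ ≤ |(θ' - θ) j * ∑ t ∈ s, c t * (y t - θ ⬝ᵥ z t) * z t j| := le_abs_self _
      _ = |(θ' - θ) j| * |∑ t ∈ s, c t * (y t - θ ⬝ᵥ z t) * z t j| := abs_mul _ _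
      _ ≤ |(θ' - θ) j| * (lam / 8) := by gcongr; exact hscore j
      _ = _ := mul_comm _ _
  rw [Finset.sum_sub_distrib, mul_sub]
  linarith

/-- Since the quadratic form is nonnegative, the penalty difference must outweigh the error mass off
the support, where θ vanishes. -/
theorem lasso_cone (s : Finset T) (c y : T → ℝ) (hc : ∀ t ∈ s, 0 ≤ c t) (z : T → ι → ℝ)
    {lam : ℝ} (hlam : 0 < lam) (θ θ' : ι → ℝ)
    (hmin : ∑ t ∈ s, c t * (y t - θ' ⬝ᵥ z t) ^ 2 + lam * ∑ j, |θ' j| ≤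
      ∑ t ∈ s, c t * (y t - θ ⬝ᵥ z t) ^ 2 + lam * ∑ j, |θ j|)
    (hscore : ∀ j, |∑ t ∈ s, c t * (y t - θ ⬝ᵥ z t) * z t j| ≤ lam / 8)
    (J : Finset ι) (hJ : ∀ j ∉ J, θ j = 0) :
    ∑ j, |(θ' - θ) j| ≤ 3 * ∑ j ∈ J, |(θ' - θ) j| := by
  classical
  have h1 := lasso_basic_inequality s c y z lam θ θ' hmin hscore
  have h0 : 0 ≤ ∑ t ∈ s, c t * ((θ' - θ) ⬝ᵥ z t) ^ 2 :=
    Finset.sum_nonneg fun t ht => mul_nonneg (hc t ht) (sq_nonneg _)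
  have h2 : ∑ j, (|θ j| - |θ' j|) ≤ ∑ j ∈ J, |(θ' - θ) j| - ∑ j ∈ Jᶜ, |(θ' - θ) j| := by
    rw [← Finset.sum_add_sum_compl J, sub_eq_add_neg, ← Finset.sum_neg_distrib]
    refine add_le_add (Finset.sum_le_sum fun j _ => ?_) (Finset.sum_le_sum fun j hj => ?_)
    · rw [Pi.sub_apply, abs_sub_comm]
      exact abs_sub_abs_le_abs_sub _ _
    · simp [hJ j (Finset.mem_compl.1 hj)]
  have h3 := Finset.sum_add_sum_compl J fun j => |(θ' - θ) j|
  have h4 : 0 ≤ lam * (1 / 4 * ∑ j, |(θ' - θ) j| +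
      (∑ j ∈ J, |(θ' - θ) j| - ∑ j ∈ Jᶜ, |(θ' - θ) j|)) := by
    have := mul_le_mul_of_nonneg_left h2 hlam.le
    linarith
  have h5 := nonneg_of_mul_nonneg_right h4 hlam
  have h6 : 0 ≤ ∑ j ∈ J, |(θ' - θ) j| := Finset.sum_nonneg fun j _ => abs_nonneg _
  -- The inequalities give (3/4)|Δ_{Jᶜ}|₁ ≤ (5/4)|Δ_J|₁, so the ratio is in fact 8/3.
  linarith

theorem restricted_eigenvalue_homogeneous (s : Finset T) (c : T → ℝ) (z : T → ι → ℝ) {κ : ℝ}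
    (J : Finset ι)
    (hRE : ∀ u : ι → ℝ, ∑ j, u j ^ 2 = 1 → ∑ j, |u j| ≤ 3 * ∑ j ∈ J, |u j| →
      κ ≤ ∑ t ∈ s, c t * (u ⬝ᵥ z t) ^ 2)
    (Δ : ι → ℝ) (hΔ : ∑ j, |Δ j| ≤ 3 * ∑ j ∈ J, |Δ j|) :
    κ * ∑ j, Δ j ^ 2 ≤ ∑ t ∈ s, c t * (Δ ⬝ᵥ z t) ^ 2 := by
  have hnn : 0 ≤ ∑ j, Δ j ^ 2 := Finset.sum_nonneg fun j _ => sq_nonneg _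
  rcases hnn.eq_or_lt with h0 | hpos
  · have hz : Δ = 0 := by
      funext j
      have := (Finset.sum_eq_zero_iff_of_nonneg fun j _ => sq_nonneg (Δ j)).1 h0.symm j
        (Finset.mem_univ j)
      simpa using this
    simp [hz]
  · set N := ∑ j, Δ j ^ 2 with hN
    set r := (Real.sqrt N)⁻¹ with hr
    have hr0 : 0 < r := inv_pos.2 (Real.sqrt_pos.2 hpos)
    have hr2 : r ^ 2 * N = 1 := by
      rw [hr, inv_pow, Real.sq_sqrt hpos.le, inv_mul_cancel₀ hpos.ne']
    have key := hRE (r • Δ) ?_ ?_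
    · have : ∑ t ∈ s, c t * ((r • Δ) ⬝ᵥ z t) ^ 2 = r ^ 2 * ∑ t ∈ s, c t * (Δ ⬝ᵥ z t) ^ 2 := by
        rw [Finset.mul_sum]
        refine Finset.sum_congr rfl fun t _ => ?_
        rw [smul_dotProduct, smul_eq_mul]
        ring
      rw [this] at key
      calc κ * N ≤ (r ^ 2 * ∑ t ∈ s, c t * (Δ ⬝ᵥ z t) ^ 2) * N := by gcongr
        _ = (r ^ 2 * N) * ∑ t ∈ s, c t * (Δ ⬝ᵥ z t) ^ 2 := by ring
        _ = _ := by rw [hr2, one_mul]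
    · simp only [Pi.smul_apply, smul_eq_mul, mul_pow, ← Finset.mul_sum]
      exact hr2
    · simp only [Pi.smul_apply, smul_eq_mul, abs_mul, ← Finset.mul_sum, abs_of_pos hr0]
      nlinarith

/-- Two index sets play different roles. `J` contains the support of θ and serves only for the cone,
so its size is irrelevant; `S` is small, determines the rate, and may miss part of θ as long as the
missed ℓ¹ mass is at most λ. -/
theorem lasso_l2_bound [DecidableEq ι] (s : Finset T) (c y : T → ℝ) (hc : ∀ t ∈ s, 0 ≤ c t) (z : T → ι → ℝ)
    {lam κ : ℝ} (hlam : 0 < lam) (hκ : 0 < κ) (θ θ' : ι → ℝ)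
    (hmin : ∑ t ∈ s, c t * (y t - θ' ⬝ᵥ z t) ^ 2 + lam * ∑ j, |θ' j| ≤
      ∑ t ∈ s, c t * (y t - θ ⬝ᵥ z t) ^ 2 + lam * ∑ j, |θ j|)
    (hscore : ∀ j, |∑ t ∈ s, c t * (y t - θ ⬝ᵥ z t) * z t j| ≤ lam / 8)
    (J : Finset ι) (hJ : ∀ j ∉ J, θ j = 0)
    (hRE : ∀ u : ι → ℝ, ∑ j, u j ^ 2 = 1 → ∑ j, |u j| ≤ 3 * ∑ j ∈ J, |u j| →
      κ ≤ ∑ t ∈ s, c t * (u ⬝ᵥ z t) ^ 2)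
    (S : Finset ι) {m : ℝ} (hm : 1 ≤ m) (hS : (S.card : ℝ) ≤ 2 * m)
    (hoff : ∑ j with j ∉ S, |θ j| ≤ lam) :
    Real.sqrt (∑ j, (θ' - θ) j ^ 2) ≤ (1 + 4 / κ) * (Real.sqrt m * lam) := by
  have h1 := lasso_basic_inequality s c y z lam θ θ' hmin hscore
  have hcone := lasso_cone s c y hc z hlam θ θ' hmin hscore J hJ
  have hre := restricted_eigenvalue_homogeneous s c z J hRE _ hcone
  set Δ := θ' - θ with hΔ
  set N := Real.sqrt (∑ j, Δ j ^ 2) with hN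
  have hnn : 0 ≤ ∑ j, Δ j ^ 2 := Finset.sum_nonneg fun j _ => sq_nonneg _
  have hN2 : N ^ 2 = ∑ j, Δ j ^ 2 := Real.sq_sqrt hnn
  have hN0 : 0 ≤ N := Real.sqrt_nonneg _
  have h2 : ∑ j, (|θ j| - |θ' j|) ≤
      ∑ j ∈ S, |Δ j| + (2 * ∑ j with j ∉ S, |θ j| - ∑ j with j ∉ S, |Δ j|) := by
    rw [← Finset.sum_filter_add_sum_filter_not Finset.univ (· ∈ S), Finset.mul_sum,
      ← Finset.sum_sub_distrib, Finset.filter_mem_eq_inter, Finset.univ_inter]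
    refine add_le_add (Finset.sum_le_sum fun j _ => ?_) (Finset.sum_le_sum fun j hj => ?_)
    · rw [hΔ, Pi.sub_apply, abs_sub_comm]
      exact abs_sub_abs_le_abs_sub _ _
    · have : |Δ j| ≤ |θ' j| + |θ j| := abs_sub _ _
      linarith
  have h3 : ∑ j, |Δ j| = ∑ j ∈ S, |Δ j| + ∑ j with j ∉ S, |Δ j| := by
    rw [← Finset.sum_filter_add_sum_filter_not Finset.univ (· ∈ S),
      Finset.filter_mem_eq_inter, Finset.univ_inter]
  have h4 : 0 ≤ ∑ j with j ∉ S, |Δ j| := Finset.sum_nonneg fun j _ => abs_nonneg _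
  have hm0 : 0 < Real.sqrt m := Real.sqrt_pos.2 (by linarith)
  have hm1 : 1 ≤ Real.sqrt m := Real.one_le_sqrt.2 hm
  have hm2 : Real.sqrt m ^ 2 = m := Real.sq_sqrt (by linarith)
  -- Cauchy–Schwarz, with √2 rounded up to 3/2.
  have h5 : ∑ j ∈ S, |Δ j| ≤ 3 / 2 * Real.sqrt m * N := by
    refine abs_le_of_sq_le_sq' ?_ (by positivity) |>.2
    calc (∑ j ∈ S, |Δ j|) ^ 2 ≤ S.card * ∑ j ∈ S, |Δ j| ^ 2 := sq_sum_le_card_mul_sum_sq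
      _ ≤ (2 * m) * ∑ j, Δ j ^ 2 := by
        simp only [sq_abs]
        gcongr
        exact Finset.subset_univ _
      _ ≤ (3 / 2 * Real.sqrt m * N) ^ 2 := by
        rw [mul_pow, mul_pow, hm2, hN2]
        nlinarith [mul_nonneg (by linarith : (0 : ℝ) ≤ m) hnn]
  set w := Real.sqrt m * lam with hw
  have hw0 : 0 < w := mul_pos hm0 hlam
  have hlw : lam ≤ w := by nlinarith
  have hmain : κ * N ^ 2 ≤ 2 * w * N + 2 * w ^ 2 := by
    rw [hN2]
    have e1 := mul_le_mul_of_nonneg_left h2 hlam.le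
    have e2 := mul_le_mul_of_nonneg_left h5 hlam.le
    have e3 := mul_le_mul_of_nonneg_left hoff hlam.le
    have e4 : 0 ≤ lam * ∑ j with j ∉ S, |Δ j| := mul_nonneg hlam.le h4
    have e5 : lam ^ 2 ≤ w ^ 2 := by gcongr
    have e6 : lam * (3 / 2 * Real.sqrt m * N) = 3 / 2 * (w * N) := by rw [hw]; ring
    have e7 : 0 ≤ w * N := mul_nonneg hw0.le hN0
    rw [h3] at h1
    nlinarith
  -- If N exceeded the bound, then N > w would turn the right side of `hmain` into less than 4wN,
  -- forcing κN < 4w.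
  by_contra hlt
  push Not at hlt
  have hN1 : w < N := by
    have : 0 < 4 / κ * w := by positivity
    nlinarith
  have hN3 : 4 * w < κ * N := by
    have : κ * ((1 + 4 / κ) * w) = κ * w + 4 * w := by field_simp
    nlinarith [mul_lt_mul_of_pos_left hlt hκ, mul_pos hκ hw0]
  nlinarith

end Lasso

/-! ### Smoothness -/

/-- The derivative is D-Lipschitz, so on the segment from x to y the remainder has derivative at
most D|y - x|. The mean value inequality then gives D in place of the sharp D/2. -/
theorem abs_taylor_one_le {f : ℝ → ℝ} {D : ℝ} (hf : ContDiffOn ℝ 2 f (Set.Icc 0 1))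
    (hD : ∀ τ ∈ Set.Icc (0 : ℝ) 1, |iteratedDerivWithin 2 f (Set.Icc 0 1) τ| ≤ D)
    {x y : ℝ} (hx : x ∈ Set.Icc (0 : ℝ) 1) (hy : y ∈ Set.Icc (0 : ℝ) 1) :
    |f y - f x - derivWithin f (Set.Icc 0 1) x * (y - x)| ≤ D * (y - x) ^ 2 := by
  have hU : UniqueDiffOn ℝ (Set.Icc (0 : ℝ) 1) := uniqueDiffOn_Icc zero_lt_one
  have hf1 : ContDiffOn ℝ 1 (derivWithin f (Set.Icc 0 1)) (Set.Icc 0 1) :=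
    hf.derivWithin hU (by norm_num)
  have hD' : ∀ τ ∈ Set.Icc (0 : ℝ) 1,
      ‖derivWithin (derivWithin f (Set.Icc 0 1)) (Set.Icc 0 1) τ‖ ≤ D := by
    intro τ hτ
    have := hD τ hτ
    rwa [iteratedDerivWithin_succ, iteratedDerivWithin_one] at this
  have hlip : ∀ u ∈ Set.Icc (0 : ℝ) 1,
      |derivWithin f (Set.Icc 0 1) u - derivWithin f (Set.Icc 0 1) x| ≤ D * |u - x| := fun u hu =>
    Convex.norm_image_sub_le_of_norm_derivWithin_le (hf1.differentiableOn (by norm_num)) hD'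
      (convex_Icc 0 1) hx hu
  have hD0 : 0 ≤ D := (abs_nonneg _).trans (hD x hx)
  have hsub : Set.uIcc x y ⊆ Set.Icc 0 1 := Set.ordConnected_Icc.uIcc_subset hx hy
  have hderiv : ∀ u ∈ Set.uIcc x y, HasDerivWithinAt
      (fun u => f u - derivWithin f (Set.Icc 0 1) x * (u - x))
      (derivWithin f (Set.Icc 0 1) u - derivWithin f (Set.Icc 0 1) x) (Set.uIcc x y) u := by
    intro u hu
    have h1 := ((hf.differentiableOn (by norm_num)) u (hsub hu)).hasDerivWithinAt.mono hsub
    have h2 := (((hasDerivAt_id u).sub_const x).const_mul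
      (derivWithin f (Set.Icc 0 1) x)).hasDerivWithinAt (s := Set.uIcc x y)
    exact (h1.fun_sub h2).congr_deriv (by simp)
  have hb : ∀ u ∈ Set.uIcc x y,
      ‖derivWithin f (Set.Icc 0 1) u - derivWithin f (Set.Icc 0 1) x‖ ≤ D * |y - x| := by
    intro u hu
    refine (hlip u (hsub hu)).trans ?_
    exact mul_le_mul_of_nonneg_left (Set.abs_sub_left_of_mem_uIcc hu) hD0
  have := Convex.norm_image_sub_le_of_norm_hasDerivWithin_le hderiv hb (convex_uIcc x y)
    Set.left_mem_uIcc Set.right_mem_uIcc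
  rw [Real.norm_eq_abs, Real.norm_eq_abs, mul_assoc, abs_mul_abs_self] at this
  calc _ = |f y - derivWithin f (Set.Icc 0 1) x * (y - x) -
        (f x - derivWithin f (Set.Icc 0 1) x * (x - x))| := by congr 1; ring
    _ ≤ _ := this.trans (by rw [sq])

/-! ### Kernel weights -/

/-- At most 2⌊nh⌋ + 1 integers lie within distance nh of m, and nh ≥ 1 absorbs the extra one. -/
theorem card_window_le {n : ℕ} {h : ℝ} (hnh : 1 ≤ n * h) (m : ℤ) :
    (((Finset.Icc 1 n).filter fun t : ℕ =>
      |scaledTime n t - scaledTime n m| ≤ h).card : ℝ) ≤ 3 * (n * h) := by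
  have hn : (0 : ℝ) < n := by
    rcases Nat.eq_zero_or_pos n with h0 | h0
    · subst h0; norm_num at hnh
    · exact_mod_cast h0
  have hsub : (((Finset.Icc 1 n).filter fun t : ℕ =>
      |scaledTime n t - scaledTime n m| ≤ h).card) ≤
      (Finset.Icc (m - ⌊n * h⌋) (m + ⌊n * h⌋)).card := by
    refine Finset.card_le_card_of_injOn (fun t : ℕ => (t : ℤ)) ?_
      (fun a _ b _ hab => by simpa using hab)
    intro t ht
    have ht := (Finset.mem_filter.1 (Finset.mem_coe.1 ht)).2
    have h1 : |((t : ℤ) - m : ℤ)| ≤ ⌊n * h⌋ := by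
      rw [Int.le_floor, Int.cast_abs]
      push_cast
      have : scaledTime n t - scaledTime n m = ((t : ℝ) - m) / n := by
        simp [scaledTime, sub_div]
      rw [this, abs_div, abs_of_pos hn, div_le_iff₀ hn] at ht
      linarith
    rw [abs_le] at h1
    simp only [Finset.coe_Icc, Set.mem_Icc]
    omega
  have hfl : 0 ≤ ⌊n * h⌋ := Int.floor_nonneg.2 (by linarith)
  have h2 : ((Finset.Icc (m - ⌊n * h⌋) (m + ⌊n * h⌋)).card : ℝ) = 2 * ⌊n * h⌋ + 1 := by
    rw [Int.card_Icc]
    have : (((m + ⌊n * h⌋ + 1 - (m - ⌊n * h⌋)).toNat : ℤ) : ℝ) = 2 * ⌊n * h⌋ + 1 := by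
      rw [Int.toNat_of_nonneg (by omega)]
      push_cast
      ring
    exact_mod_cast this
  have h3 : (⌊n * h⌋ : ℝ) ≤ n * h := Int.floor_le _
  have h4 : (((Finset.Icc 1 n).filter fun t : ℕ =>
      |scaledTime n t - scaledTime n m| ≤ h).card : ℝ) ≤ 2 * ⌊n * h⌋ + 1 := by
    rw [← h2]; exact_mod_cast hsub
  linarith

/-- The weight `n⁻¹ ((τ_t - τ) / h)^k K_h(τ_t - τ)`. -/
noncomputable def locWeight (n : ℕ) (K : ℝ → ℝ) (h τ : ℝ) (k t : ℕ) : ℝ :=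
  1 / (n : ℝ) * (((scaledTime n t - τ) / h) ^ k * scaledKernel K h (scaledTime n t - τ))

theorem locWeight_eq_zero {n : ℕ} {K : ℝ → ℝ} (hK : IsKernel K) {h τ : ℝ} (hh : 0 < h) (k : ℕ)
    {t : ℕ} (ht : ¬ |scaledTime n t - τ| ≤ h) : locWeight n K h τ k t = 0 := by
  have : K ((scaledTime n t - τ) / h) = 0 := by
    apply hK.support
    rw [abs_div, abs_of_pos hh, lt_div_iff₀ hh]
    linarith
  simp [locWeight, scaledKernel, this]

theorem abs_locWeight_le {n : ℕ} {K : ℝ → ℝ} (hK : IsKernel K) {B : ℝ} (hB : ∀ x, K x ≤ B)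
    {h τ : ℝ} (hh : 0 < h) (k t : ℕ) : |locWeight n K h τ k t| ≤ B / (n * h) := by
  have hB0 : 0 ≤ B := (hK.nonneg 0).trans (hB 0)
  by_cases ht : |scaledTime n t - τ| ≤ h
  · have h1 : |(scaledTime n t - τ) / h| ≤ 1 := by
      rw [abs_div, abs_of_pos hh]
      exact div_le_one_of_le₀ ht hh.le
    rw [locWeight, scaledKernel, abs_mul, abs_mul, abs_pow, abs_mul, abs_of_nonneg (hK.nonneg _),
      abs_of_pos (inv_pos.2 hh), abs_of_nonneg (by positivity : (0 : ℝ) ≤ 1 / n)]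
    calc 1 / (n : ℝ) * (|(scaledTime n t - τ) / h| ^ k * (h⁻¹ * K ((scaledTime n t - τ) / h)))
        ≤ 1 / (n : ℝ) * (1 * (h⁻¹ * B)) := by
          gcongr
          · exact mul_nonneg (inv_pos.2 hh).le (hK.nonneg _)
          · exact pow_le_one₀ (abs_nonneg _) h1
          · exact hB _
      _ = B / (n * h) := by
        rw [one_mul, one_div, div_eq_mul_inv, mul_inv]; ring
  · rw [locWeight_eq_zero hK hh k ht, abs_zero]
    positivity

/-- The case p = 1 serves the bias, the case p = 2 the variance proxy of the score. -/
theorem sum_locWeight_pow_le {n : ℕ} {K : ℝ → ℝ} (hK : IsKernel K) {B : ℝ} (hB : ∀ x, K x ≤ B)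
    {h : ℝ} (hh : 0 < h) (hnh : 1 ≤ n * h) (m : ℤ) (k : ℕ) {p : ℕ} (hp : p ≠ 0) :
    ∑ t ∈ Finset.Icc 1 n, |locWeight n K h (scaledTime n m) k t| ^ p ≤
      3 * (n * h) * (B / (n * h)) ^ p := by
  have hB0 : 0 ≤ B := (hK.nonneg 0).trans (hB 0)
  rw [← Finset.sum_filter_of_ne (p := fun t : ℕ => |scaledTime n t - scaledTime n m| ≤ h)]
  · calc _ ≤ ∑ t ∈ (Finset.Icc 1 n).filter fun t : ℕ =>
          |scaledTime n t - scaledTime n m| ≤ h, (B / (n * h)) ^ p :=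
        Finset.sum_le_sum fun t _ => pow_le_pow_left₀ (abs_nonneg _)
          (abs_locWeight_le hK hB hh k t) p
      _ ≤ _ := by
        rw [Finset.sum_const, nsmul_eq_mul]
        gcongr
        exact card_window_le hnh m
  · intro t _ hne
    by_contra hcon
    exact hne (by rw [locWeight_eq_zero hK hh k hcon]; simp [hp])

/-! ### The local linear LASSO as a LASSO in `2 d` variables -/

section Path

variable {n d : ℕ} {K : ℝ → ℝ} {h : ℝ} {x : ℤ → Fin d → ℝ} {τ : ℝ}

/-- The regressor `(X_{t-1}, ((τ_t - τ) / h) X_{t-1})` of the local linear regression. -/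
noncomputable def regressor (n : ℕ) {d : ℕ} (h : ℝ) (x : ℤ → Fin d → ℝ) (τ : ℝ) (t : ℕ) :
    Fin d ⊕ Fin d → ℝ :=
  Sum.elim (x ((t : ℤ) - 1)) (((scaledTime n t - τ) / h) • x ((t : ℤ) - 1))

theorem dotProduct_regressor (u v : Fin d → ℝ) (t : ℕ) :
    Sum.elim u v ⬝ᵥ regressor n h x τ t =
      u ⬝ᵥ x ((t : ℤ) - 1) + (scaledTime n t - τ) / h * (v ⬝ᵥ x ((t : ℤ) - 1)) := by
  rw [regressor, sumElim_dotProduct_sumElim, dotProduct_smul, smul_eq_mul]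

theorem dotProduct_psi (k : ℕ) (u v : Fin d → ℝ) :
    u ⬝ᵥ Matrix.mulVec (psi n K h x τ k) v = ∑ t ∈ Finset.Icc 1 n,
      locWeight n K h τ k t * ((u ⬝ᵥ x ((t : ℤ) - 1)) * (v ⬝ᵥ x ((t : ℤ) - 1))) := by
  rw [psi, Matrix.smul_mulVec, dotProduct_smul, Matrix.sum_mulVec, dotProduct_sum,
    Finset.smul_sum]
  refine Finset.sum_congr rfl fun t _ => ?_
  rw [Matrix.smul_mulVec, dotProduct_smul, Matrix.vecMulVec_mulVec, dotProduct_smul, locWeight]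
  simp only [smul_eq_mul, MulOpposite.smul_eq_mul_unop, MulOpposite.unop_op]
  rw [dotProduct_comm (x ((t : ℤ) - 1)) v]
  ring

theorem dotProduct_psiBlock (u : Fin d ⊕ Fin d → ℝ) :
    u ⬝ᵥ Matrix.mulVec (psiBlock n K h x τ) u = ∑ t ∈ Finset.Icc 1 n,
      locWeight n K h τ 0 t * (u ⬝ᵥ regressor n h x τ t) ^ 2 := by
  obtain ⟨u₁, u₂, rfl⟩ : ∃ u₁ u₂ : Fin d → ℝ, u = Sum.elim u₁ u₂ :=
    ⟨u ∘ Sum.inl, u ∘ Sum.inr, (Sum.elim_comp_inl_inr u).symm⟩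
  rw [psiBlock, Matrix.fromBlocks_mulVec, sumElim_dotProduct_sumElim]
  simp only [Sum.elim_comp_inl, Sum.elim_comp_inr, dotProduct_add, dotProduct_psi,
    ← Finset.sum_add_distrib]
  refine Finset.sum_congr rfl fun t _ => ?_
  rw [dotProduct_regressor]
  simp only [locWeight]
  ring

/-- Scaling the slope by h balances the regressor and makes the two penalties a single unweighted ℓ¹
norm. -/
theorem lassoLoss_eq (hh : 0 < h) (lam : ℝ) (i : Fin d) (α β : Fin d → ℝ) :
    lassoLoss n K h lam x i τ α β = ∑ t ∈ Finset.Icc 1 n,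
      locWeight n K h τ 0 t * (x t i - Sum.elim α (h • β) ⬝ᵥ regressor n h x τ t) ^ 2 +
        lam * ∑ j, |Sum.elim α (h • β) j| := by
  rw [lassoLoss, localLoss]
  congr 1
  · rw [Finset.mul_sum]
    refine Finset.sum_congr rfl fun t _ => ?_
    rw [dotProduct_regressor, add_dotProduct, smul_dotProduct, smul_dotProduct, locWeight,
      smul_eq_mul, smul_eq_mul]
    have : (scaledTime n t - τ) / h * (h * (β ⬝ᵥ x ((t : ℤ) - 1))) =
      (scaledTime n t - τ) * (β ⬝ᵥ x ((t : ℤ) - 1)) := by field_simp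
    rw [this]
    ring
  · rw [Fintype.sum_sum_type]
    simp [abs_mul, abs_of_pos hh, Finset.mul_sum]

theorem locWeight_zero_nonneg (hK : IsKernel K) (hh : 0 < h) (t : ℕ) :
    0 ≤ locWeight n K h τ 0 t := by
  have := hK.nonneg ((scaledTime n t - τ) / h)
  rw [locWeight, scaledKernel]
  positivity

theorem mem_restrictedSet_iff {A : ℝ → Matrix (Fin d) (Fin d) ℝ} {i : Fin d}
    {u : Fin d ⊕ Fin d → ℝ} :
    u ∈ restrictedSet A i τ ↔ ∑ j, u j ^ 2 = 1 ∧
      ∑ j, |u j| ≤ 3 * ∑ j ∈ (activeSet A i τ).disjSum (activeDerivSet A i τ), |u j| := by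
  rw [restrictedSet, Set.mem_ofPred_eq, Fintype.sum_sum_type, Fintype.sum_sum_type,
    Finset.sum_add_distrib, Finset.sum_disjSum]

/-- Under the restricted eigenvalue condition there are no more nonzero derivatives than
observations in the local window. -/
theorem card_activeDerivSet_le {A : ℝ → Matrix (Fin d) (Fin d) ℝ} {i : Fin d} {κ : ℝ}
    (hK : IsKernel K) (hh : 0 < h) (hκ : 0 < κ)
    (hRE : ∀ u ∈ restrictedSet A i τ, κ ≤ u ⬝ᵥ Matrix.mulVec (psiBlock n K h x τ) u) :
    (activeDerivSet A i τ).card ≤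
      ((Finset.Icc 1 n).filter fun t : ℕ => |scaledTime n t - τ| ≤ h).card := by
  classical
  by_contra! hlt
  set W := (Finset.Icc 1 n).filter fun t : ℕ => |scaledTime n t - τ| ≤ h with hW
  set J := activeDerivSet A i τ with hJ
  -- With fewer rows than columns, M kills some nonzero v. Extended by zero, (0, v) lies in the cone
  -- because it is supported on the active derivatives, yet its quadratic form vanishes since the
  -- kernel sees only the window.
  let M : Matrix W J ℝ := fun t j => x (((t : ℕ) : ℤ) - 1) j
  have hker := LinearMap.ker_ne_bot_of_finrank_lt (f := Matrix.toLin' M) (by simpa using hlt)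
  obtain ⟨v, hv, hv0⟩ := Submodule.exists_mem_ne_zero_of_ne_bot hker
  rw [LinearMap.mem_ker, Matrix.toLin'_apply] at hv
  let w : Fin d → ℝ := fun j => if hj : j ∈ J then v ⟨j, hj⟩ else 0
  have hwz : ∀ j ∉ J, w j = 0 := fun j hj => by simp [w, hj]
  have hsum : ∀ f : Fin d → ℝ, ∑ j, w j * f j = ∑ j : J, v j * f j := by
    intro f
    rw [← Finset.sum_subset (Finset.subset_univ J) fun j _ hj => by rw [hwz j hj, zero_mul],
      ← Finset.sum_coe_sort J]
    refine Finset.sum_congr rfl fun j _ => ?_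
    simp [w]
  have horth : ∀ t ∈ W, w ⬝ᵥ x ((t : ℤ) - 1) = 0 := by
    intro t ht
    rw [dotProduct, hsum]
    refine Eq.trans (Finset.sum_congr rfl fun j _ => mul_comm _ _) (congrFun hv ⟨t, ht⟩)
  have hre := restricted_eigenvalue_homogeneous (Finset.Icc 1 n) (locWeight n K h τ 0)
    (regressor n h x τ) ((activeSet A i τ).disjSum J) (κ := κ)
    (fun u h1 h2 => by
      rw [← dotProduct_psiBlock]
      exact hRE u (mem_restrictedSet_iff.2 ⟨h1, h2⟩))
    (Sum.elim 0 w) ?_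
  · have hQ : ∑ t ∈ Finset.Icc 1 n, locWeight n K h τ 0 t *
        (Sum.elim 0 w ⬝ᵥ regressor n h x τ t) ^ 2 = 0 := by
      refine Finset.sum_eq_zero fun t ht => ?_
      by_cases htW : |scaledTime n t - τ| ≤ h
      · rw [dotProduct_regressor, horth t (Finset.mem_filter.2 ⟨ht, htW⟩)]
        simp
      · rw [locWeight_eq_zero hK hh 0 htW, zero_mul]
    rw [hQ, Fintype.sum_sum_type] at hre
    simp only [Sum.elim_inl, Sum.elim_inr, Pi.zero_apply] at hre
    have h0 : ∑ j, w j ^ 2 ≤ 0 := by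
      have : κ * ∑ j, w j ^ 2 ≤ 0 := by simpa using hre
      exact nonpos_of_mul_nonpos_right this hκ
    apply hv0
    funext j
    have := (Finset.sum_eq_zero_iff_of_nonneg fun j _ => sq_nonneg (w j)).1
      (le_antisymm h0 (Finset.sum_nonneg fun j _ => sq_nonneg (w j))) j (Finset.mem_univ _)
    simpa [w] using this
  · rw [Fintype.sum_sum_type, Finset.sum_disjSum]
    simp only [Sum.elim_inl, Sum.elim_inr, Pi.zero_apply, abs_zero, Finset.sum_const_zero,
      zero_add]
    rw [← Finset.sum_subset (Finset.subset_univ J) fun j _ hj => by rw [hwz j hj, abs_zero]]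
    have : 0 ≤ ∑ j ∈ J, |w j| := Finset.sum_nonneg fun _ _ => abs_nonneg _
    linarith

/-- The union of the supports of the `i`-th row over the observed time points. -/
noncomputable def gridSupport (n : ℕ) {d : ℕ} (A : ℝ → Matrix (Fin d) (Fin d) ℝ) (i : Fin d) :
    Finset (Fin d) :=
  (Finset.Icc 1 n).biUnion fun t : ℕ => activeSet A i (scaledTime n t)

theorem coef_eq_zero_of_notMem_gridSupport {A : ℝ → Matrix (Fin d) (Fin d) ℝ} {i j : Fin d}
    (hj : j ∉ gridSupport n A i) {t : ℕ} (ht : t ∈ Finset.Icc 1 n) :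
    A (scaledTime n t) i j = 0 := by
  by_contra hne
  exact hj (Finset.mem_biUnion.2 ⟨t, ht, Finset.mem_filter.2 ⟨Finset.mem_univ _, hne⟩⟩)

theorem scaledTime_mem_Icc {t : ℕ} (ht : t ∈ Finset.Icc 1 n) :
    scaledTime n t ∈ Set.Icc (0 : ℝ) 1 := by
  rw [Finset.mem_Icc] at ht
  have h1 : (t : ℝ) ≤ n := by exact_mod_cast ht.2
  refine ⟨?_, ?_⟩
  · simp only [scaledTime, Int.cast_natCast]; positivity
  · simp only [scaledTime, Int.cast_natCast]
    exact div_le_one_of_le₀ h1 (by positivity)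

/-- The coefficient is zero at τ_m and at an adjacent grid point, so Taylor's formula leaves
|slope|/n ≤ D/n². Because n ≥ 2 a neighbour exists; at m = n it is the one on the left. -/
theorem abs_coefDeriv_le_of_notMem_gridSupport {A : ℝ → Matrix (Fin d) (Fin d) ℝ} {D : ℝ}
    {i j : Fin d}
    (hA : ContDiffOn ℝ 2 (fun τ => A τ i j) (Set.Icc 0 1))
    (hD : ∀ τ ∈ Set.Icc (0 : ℝ) 1,
      |iteratedDerivWithin 2 (fun τ => A τ i j) (Set.Icc 0 1) τ| ≤ D)
    (hn : 2 ≤ n) (hj : j ∉ gridSupport n A i) {m : ℕ} (hm : m ∈ Finset.Icc 1 n) :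
    |coefDeriv A i (scaledTime n m) j| ≤ D / n := by
  have hn0 : (0 : ℝ) < n := by exact_mod_cast (by omega : 0 < n)
  obtain ⟨m', hm', hdiff⟩ : ∃ m' ∈ Finset.Icc 1 n,
      |scaledTime n m' - scaledTime n m| = 1 / n := by
    rw [Finset.mem_Icc] at hm
    rcases Nat.lt_or_ge m n with hlt | hge
    · refine ⟨m + 1, Finset.mem_Icc.2 ⟨by omega, by omega⟩, ?_⟩
      have : scaledTime n (m + 1 : ℕ) - scaledTime n m = 1 / n := by
        simp only [scaledTime]; push_cast; ring
      rw [this, abs_of_pos (by positivity)]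
    · refine ⟨m - 1, Finset.mem_Icc.2 ⟨by omega, by omega⟩, ?_⟩
      have : scaledTime n (m - 1 : ℕ) - scaledTime n m = -(1 / n) := by
        simp only [scaledTime]; push_cast [Nat.cast_sub (by omega : 1 ≤ m)]; ring
      rw [this, abs_neg, abs_of_pos (by positivity)]
  have := abs_taylor_one_le hA hD (scaledTime_mem_Icc hm) (scaledTime_mem_Icc hm')
  simp only [coef_eq_zero_of_notMem_gridSupport hj hm,
    coef_eq_zero_of_notMem_gridSupport hj hm', sub_zero, zero_sub, abs_neg, abs_mul, hdiff] at this
  rw [← sq_abs, hdiff] at this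
  change |coefDeriv A i (scaledTime n m) j| * (1 / n) ≤ D * (1 / n) ^ 2 at this
  rw [← mul_le_mul_iff_left₀ (by positivity : (0 : ℝ) < 1 / n)]
  calc _ ≤ _ := this
    _ = _ := by ring

/-- At most 3nh slopes are nonzero, and each one off the grid support is at most D/n. -/
theorem sum_abs_coefDeriv_le {A : ℝ → Matrix (Fin d) (Fin d) ℝ} {D κ : ℝ} {i : Fin d}
    (hA : ∀ j, ContDiffOn ℝ 2 (fun τ => A τ i j) (Set.Icc 0 1))
    (hD : ∀ j, ∀ τ ∈ Set.Icc (0 : ℝ) 1,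
      |iteratedDerivWithin 2 (fun τ => A τ i j) (Set.Icc 0 1) τ| ≤ D)
    (hn : 2 ≤ n) (hK : IsKernel K) (hh : 0 < h) (hnh : 1 ≤ n * h) (hκ : 0 < κ)
    {m : ℕ} (hm : m ∈ Finset.Icc 1 n)
    (hRE : ∀ u ∈ restrictedSet A i (scaledTime n m),
      κ ≤ u ⬝ᵥ Matrix.mulVec (psiBlock n K h x (scaledTime n m)) u) :
    ∑ j with j ∉ gridSupport n A i, |coefDeriv A i (scaledTime n m) j| ≤ 3 * D * h := by
  have hn0 : (0 : ℝ) < n := by exact_mod_cast (by omega : 0 < n)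
  have hD0 : 0 ≤ D := (abs_nonneg _).trans (hD i 0 (by simp))
  calc ∑ j with j ∉ gridSupport n A i, |coefDeriv A i (scaledTime n m) j|
      ≤ ∑ j ∈ activeDerivSet A i (scaledTime n m), D / n := by
        rw [← Finset.sum_filter_ne_zero]
        refine (Finset.sum_le_sum (g := fun _ => D / n) fun j hj => ?_).trans
          (Finset.sum_le_sum_of_subset_of_nonneg ?_ fun _ _ _ => by positivity)
        · exact abs_coefDeriv_le_of_notMem_gridSupport (hA j) (hD j) hn
            (Finset.mem_filter.1 (Finset.mem_filter.1 hj).1).2 hm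
        · intro j hj
          simpa [activeDerivSet] using (Finset.mem_filter.1 hj).2
    _ ≤ (3 * (n * h)) * (D / n) := by
        rw [Finset.sum_const, nsmul_eq_mul]
        gcongr
        refine le_trans ?_ (card_window_le hnh m)
        exact_mod_cast card_activeDerivSet_le hK hh hκ hRE
    _ = 3 * D * h := by field_simp

/-- Coordinates in the grid support contribute at most sDh². For the others only the slope term
survives, contributing at most 3Dh², which s ≥ 1 absorbs. -/
theorem sum_abs_taylor_coef_le {A : ℝ → Matrix (Fin d) (Fin d) ℝ} {D κ : ℝ} {i : Fin d}
    (hA : ∀ j, ContDiffOn ℝ 2 (fun τ => A τ i j) (Set.Icc 0 1))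
    (hD : ∀ j, ∀ τ ∈ Set.Icc (0 : ℝ) 1,
      |iteratedDerivWithin 2 (fun τ => A τ i j) (Set.Icc 0 1) τ| ≤ D)
    (hn : 2 ≤ n) (hK : IsKernel K) (hh : 0 < h) (hnh : 1 ≤ n * h) (hκ : 0 < κ)
    {m : ℕ} (hm : m ∈ Finset.Icc 1 n)
    (hRE : ∀ u ∈ restrictedSet A i (scaledTime n m),
      κ ≤ u ⬝ᵥ Matrix.mulVec (psiBlock n K h x (scaledTime n m)) u)
    {s : ℕ} (hs : 1 ≤ s) (hcard : (gridSupport n A i).card ≤ s)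
    {t : ℕ} (ht : t ∈ Finset.Icc 1 n) (hwin : |scaledTime n t - scaledTime n m| ≤ h) :
    ∑ j, |A (scaledTime n t) i j - A (scaledTime n m) i j -
      coefDeriv A i (scaledTime n m) j * (scaledTime n t - scaledTime n m)| ≤
        4 * D * (s * h ^ 2) := by
  have hD0 : 0 ≤ D := (abs_nonneg _).trans (hD i 0 (by simp))
  have hs1 : (1 : ℝ) ≤ s := by exact_mod_cast hs
  have hcard' : ((gridSupport n A i).card : ℝ) ≤ s := by exact_mod_cast hcard
  rw [← Finset.sum_filter_add_sum_filter_not Finset.univ (· ∈ gridSupport n A i)]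
  have h1 : ∑ j with j ∈ gridSupport n A i, |A (scaledTime n t) i j - A (scaledTime n m) i j -
      coefDeriv A i (scaledTime n m) j * (scaledTime n t - scaledTime n m)| ≤ s * (D * h ^ 2) := by
    rw [Finset.filter_mem_eq_inter, Finset.univ_inter]
    calc _ ≤ ∑ j ∈ gridSupport n A i, D * h ^ 2 := by
          refine Finset.sum_le_sum fun j _ => ?_
          refine (abs_taylor_one_le (hA j) (hD j) (scaledTime_mem_Icc hm)
            (scaledTime_mem_Icc ht)).trans ?_
          rw [← sq_abs]
          gcongr
      _ ≤ _ := by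
        rw [Finset.sum_const, nsmul_eq_mul]
        gcongr
  have h2 : ∑ j with j ∉ gridSupport n A i, |A (scaledTime n t) i j - A (scaledTime n m) i j -
      coefDeriv A i (scaledTime n m) j * (scaledTime n t - scaledTime n m)| ≤ 3 * D * h * h := by
    calc _ ≤ ∑ j with j ∉ gridSupport n A i, |coefDeriv A i (scaledTime n m) j| * h := by
          refine Finset.sum_le_sum fun j hj => ?_
          have hj := (Finset.mem_filter.1 hj).2
          rw [coef_eq_zero_of_notMem_gridSupport hj hm, coef_eq_zero_of_notMem_gridSupport hj ht,
            sub_zero, zero_sub, abs_neg, abs_mul]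
          gcongr
      _ ≤ _ := by
        rw [← Finset.sum_mul]
        gcongr
        exact sum_abs_coefDeriv_le hA hD hn hK hh hnh hκ hm hRE
  have h3 : 3 * D * h * h ≤ s * (3 * D * h * h) := by
    have : 0 ≤ 3 * D * h * h := by positivity
    nlinarith
  linarith

theorem l2Norm_eq_sqrt (v : Fin d → ℝ) : l2Norm v = Real.sqrt (∑ j, v j ^ 2) := by
  simp [l2Norm, EuclideanSpace.norm_eq]

/-- The deterministic error bound for the local linear LASSO on a path for which the noise score
is bounded by `g` and the observations are bounded by `b`. -/
theorem lasso_path_bound {A : ℝ → Matrix (Fin d) (Fin d) ℝ} {D κ B b g lam : ℝ} {i : Fin d}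
    (hA : ∀ j, ContDiffOn ℝ 2 (fun τ => A τ i j) (Set.Icc 0 1))
    (hD : ∀ j, ∀ τ ∈ Set.Icc (0 : ℝ) 1,
      |iteratedDerivWithin 2 (fun τ => A τ i j) (Set.Icc 0 1) τ| ≤ D)
    (hn : 2 ≤ n) (hK : IsKernel K) (hB : ∀ y, K y ≤ B) (hh : 0 < h) (hnh : 1 ≤ n * h)
    (hκ : 0 < κ) (hlam : 0 < lam) {m : ℕ} (hm : m ∈ Finset.Icc 1 n)
    (hRE : ∀ u ∈ restrictedSet A i (scaledTime n m),
      κ ≤ u ⬝ᵥ Matrix.mulVec (psiBlock n K h x (scaledTime n m)) u)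
    {s : ℕ} (hs : 1 ≤ s) (hcard : (gridSupport n A i).card ≤ s)
    (e : ℕ → ℝ)
    (hrec : ∀ t ∈ Finset.Icc 1 n, x t i = (fun j => A (scaledTime n t) i j) ⬝ᵥ x ((t : ℤ) - 1) + e t)
    (hb : ∀ t ∈ Finset.Icc 1 n, ∀ j, |x ((t : ℤ) - 1) j| ≤ b)
    (hg : ∀ k ≤ 1, ∀ j, |∑ t ∈ Finset.Icc 1 n,
      locWeight n K h (scaledTime n m) k t * x ((t : ℤ) - 1) j * e t| ≤ g)
    (hscore : g + 12 * B * D * b ^ 2 * (s * h ^ 2) ≤ lam / 8)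
    (hpen : 3 * D * h ^ 2 ≤ lam)
    {α β : Fin d → ℝ} (hest : IsLassoEstimate n K h lam x i (scaledTime n m) α β) :
    l2Norm (α - coef A i (scaledTime n m)) + h * l2Norm (β - coefDeriv A i (scaledTime n m)) ≤
      2 * ((1 + 4 / κ) * (Real.sqrt s * lam)) := by
  set τ := scaledTime n m with hτ
  have hn0 : (0 : ℝ) < n := by exact_mod_cast (by omega : 0 < n)
  have hnh0 : 0 < n * h := by positivity
  have hB0 : 0 ≤ B := (hK.nonneg 0).trans (hB 0)
  have hD0 : 0 ≤ D := (abs_nonneg _).trans (hD i 0 (by simp))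
  have hb0 : 0 ≤ b := (abs_nonneg _).trans (hb m hm i)
  have hs1 : (1 : ℝ) ≤ s := by exact_mod_cast hs
  set θ : Fin d ⊕ Fin d → ℝ := Sum.elim (coef A i τ) (h • coefDeriv A i τ) with hθ
  set θ' : Fin d ⊕ Fin d → ℝ := Sum.elim α (h • β) with hθ'
  have hmin := hest (coef A i τ) (coefDeriv A i τ)
  rw [lassoLoss_eq hh, lassoLoss_eq hh] at hmin
  let δ : ℕ → Fin d → ℝ := fun t j =>
    A (scaledTime n t) i j - A τ i j - coefDeriv A i τ j * (scaledTime n t - τ)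
  have hresid : ∀ t ∈ Finset.Icc 1 n, x t i - θ ⬝ᵥ regressor n h x τ t =
      e t + δ t ⬝ᵥ x ((t : ℤ) - 1) := by
    intro t ht
    have : δ t = (fun j => A (scaledTime n t) i j) - coef A i τ -
        (scaledTime n t - τ) • coefDeriv A i τ := by
      funext j
      simp only [δ, coef, Pi.sub_apply, Pi.smul_apply, smul_eq_mul]
      ring
    rw [hrec t ht, hθ, dotProduct_regressor, this, sub_dotProduct, sub_dotProduct,
      smul_dotProduct, smul_dotProduct, smul_eq_mul, smul_eq_mul]
    field_simp
    ring
  have hsc : ∀ k ≤ 1, ∀ j, |∑ t ∈ Finset.Icc 1 n,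
      locWeight n K h τ k t * (x t i - θ ⬝ᵥ regressor n h x τ t) * x ((t : ℤ) - 1) j| ≤
        lam / 8 := by
    intro k hk j
    have hsplit : ∑ t ∈ Finset.Icc 1 n,
        locWeight n K h τ k t * (x t i - θ ⬝ᵥ regressor n h x τ t) * x ((t : ℤ) - 1) j =
        ∑ t ∈ Finset.Icc 1 n, locWeight n K h τ k t * x ((t : ℤ) - 1) j * e t +
        ∑ t ∈ Finset.Icc 1 n,
          locWeight n K h τ k t * (δ t ⬝ᵥ x ((t : ℤ) - 1)) * x ((t : ℤ) - 1) j := by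
      rw [← Finset.sum_add_distrib]
      refine Finset.sum_congr rfl fun t ht => ?_
      rw [hresid t ht]
      ring
    -- Total absolute weight 3B, times ℓ¹ Taylor error 4Dsh², times b² from the two state factors.
    have hbias : |∑ t ∈ Finset.Icc 1 n,
        locWeight n K h τ k t * (δ t ⬝ᵥ x ((t : ℤ) - 1)) * x ((t : ℤ) - 1) j| ≤
        12 * B * D * b ^ 2 * (s * h ^ 2) := by
      calc _ ≤ ∑ t ∈ Finset.Icc 1 n,
            |locWeight n K h τ k t| ^ 1 * (4 * D * (s * h ^ 2) * b * b) := by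
            refine (Finset.abs_sum_le_sum_abs _ _).trans (Finset.sum_le_sum fun t ht => ?_)
            by_cases hwin : |scaledTime n t - τ| ≤ h
            · rw [abs_mul, abs_mul, pow_one, mul_assoc]
              refine mul_le_mul_of_nonneg_left ?_ (abs_nonneg _)
              refine mul_le_mul ?_ (hb t ht j) (abs_nonneg _) (by positivity)
              calc |δ t ⬝ᵥ x ((t : ℤ) - 1)| ≤ ∑ l, |δ t l * x ((t : ℤ) - 1) l| :=
                    Finset.abs_sum_le_sum_abs _ _
                _ ≤ ∑ l, |δ t l| * b := by
                    refine Finset.sum_le_sum fun l _ => ?_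
                    rw [abs_mul]
                    exact mul_le_mul_of_nonneg_left (hb t ht l) (abs_nonneg _)
                _ ≤ _ := by
                    rw [← Finset.sum_mul]
                    refine mul_le_mul_of_nonneg_right ?_ hb0
                    exact sum_abs_taylor_coef_le hA hD hn hK hh hnh hκ hm hRE hs hcard ht hwin
            · rw [locWeight_eq_zero hK hh k hwin]
              simp
        _ ≤ (3 * (n * h) * (B / (n * h)) ^ 1) * (4 * D * (s * h ^ 2) * b * b) := by
            rw [← Finset.sum_mul]
            refine mul_le_mul_of_nonneg_right ?_ (by positivity)
            exact sum_locWeight_pow_le hK hB hh hnh m k one_ne_zero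
        _ = _ := by
            rw [pow_one]
            field_simp
            ring
    rw [hsplit]
    exact (abs_add_le _ _).trans ((add_le_add (hg k hk j) hbias).trans hscore)
  have hscore' : ∀ j, |∑ t ∈ Finset.Icc 1 n, locWeight n K h τ 0 t *
      (x t i - θ ⬝ᵥ regressor n h x τ t) * regressor n h x τ t j| ≤ lam / 8 := by
    rintro (j | j)
    · simpa [regressor] using hsc 0 zero_le_one j
    · refine le_of_eq_of_le (congrArg _ (Finset.sum_congr rfl fun t _ => ?_)) (hsc 1 le_rfl j)
      simp only [regressor, Sum.elim_inr, Pi.smul_apply, smul_eq_mul, locWeight]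
      ring
  have hJ : ∀ j ∉ (activeSet A i τ).disjSum (activeDerivSet A i τ), θ j = 0 := by
    rintro (j | j) hj
    · simpa [activeSet, hθ] using hj
    · have : coefDeriv A i τ j = 0 := by simpa [activeDerivSet] using hj
      simp [hθ, this]
  have hoff : ∑ j with j ∉ (gridSupport n A i).disjSum (gridSupport n A i), |θ j| ≤ lam := by
    rw [Finset.sum_filter, Fintype.sum_sum_type]
    have e1 : ∀ j : Fin d, (if Sum.inl j ∉ (gridSupport n A i).disjSum (gridSupport n A i) then
        |θ (Sum.inl j)| else 0) = 0 := by
      intro j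
      by_cases hj : j ∈ gridSupport n A i
      · simp [hj]
      · have : coef A i τ j = 0 := coef_eq_zero_of_notMem_gridSupport hj hm
        simp [hθ, this]
    have e2 : ∀ j : Fin d, (if Sum.inr j ∉ (gridSupport n A i).disjSum (gridSupport n A i) then
        |θ (Sum.inr j)| else 0) = h * if j ∉ gridSupport n A i then |coefDeriv A i τ j| else 0 := by
      intro j
      simp [hθ, abs_mul, abs_of_pos hh]
    simp only [e1, e2, Finset.sum_const_zero, zero_add, ← Finset.mul_sum]
    rw [← Finset.sum_filter]
    calc _ ≤ h * (3 * D * h) := mul_le_mul_of_nonneg_left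
          (sum_abs_coefDeriv_le hA hD hn hK hh hnh hκ hm hRE) hh.le
      _ = 3 * D * h ^ 2 := by ring
      _ ≤ lam := hpen
  have key := lasso_l2_bound (Finset.Icc 1 n) (locWeight n K h τ 0) (fun t => x t i)
    (fun t _ => locWeight_zero_nonneg hK hh t) (regressor n h x τ) hlam hκ θ θ' hmin hscore'
    ((activeSet A i τ).disjSum (activeDerivSet A i τ)) hJ
    (fun u h1 h2 => by
      rw [← dotProduct_psiBlock]
      exact hRE u (mem_restrictedSet_iff.2 ⟨h1, h2⟩))
    ((gridSupport n A i).disjSum (gridSupport n A i)) hs1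
    (by
      rw [Finset.card_disjSum]
      have : ((gridSupport n A i).card : ℝ) ≤ s := by exact_mod_cast hcard
      push_cast
      linarith) hoff
  rw [Fintype.sum_sum_type] at key
  have hl : l2Norm (α - coef A i τ) ≤ (1 + 4 / κ) * (Real.sqrt s * lam) := by
    rw [l2Norm_eq_sqrt]
    refine (Real.sqrt_le_sqrt ?_).trans key
    have : 0 ≤ ∑ j, (θ' - θ) (Sum.inr j) ^ 2 := Finset.sum_nonneg fun _ _ => sq_nonneg _
    simpa [hθ, hθ'] using this
  have hr : h * l2Norm (β - coefDeriv A i τ) ≤ (1 + 4 / κ) * (Real.sqrt s * lam) := by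
    rw [l2Norm_eq_sqrt, ← Real.sqrt_sq hh.le, ← Real.sqrt_mul (sq_nonneg h)]
    refine (Real.sqrt_le_sqrt ?_).trans key
    have h0 : 0 ≤ ∑ j, (θ' - θ) (Sum.inl j) ^ 2 := Finset.sum_nonneg fun _ _ => sq_nonneg _
    have h1 : h ^ 2 * ∑ j, (β - coefDeriv A i τ) j ^ 2 = ∑ j, (θ' - θ) (Sum.inr j) ^ 2 := by
      rw [Finset.mul_sum]
      refine Finset.sum_congr rfl fun j _ => ?_
      simp only [hθ, hθ', Pi.sub_apply, Sum.elim_inr, Pi.smul_apply, smul_eq_mul]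
      ring
    linarith
  linarith

end Path

/-! ### Sub-Gaussian estimates -/

/-- The linear term is kept separate so that it disappears on integrating a centred variable. -/
theorem exp_le_add_exp_sq (x : ℝ) : Real.exp x ≤ x + Real.exp (x ^ 2) := by
  rcases le_or_gt |x| 1 with h | h
  · have h1 := (abs_le.1 (Real.abs_exp_sub_one_sub_id_le h)).2
    have h2 := Real.add_one_le_exp (x ^ 2)
    linarith
  · rcases lt_abs.1 h with h' | h'
    · have : Real.exp x ≤ Real.exp (x ^ 2) := Real.exp_le_exp.2 (by nlinarith)
      linarith
    · have h1 : Real.exp x ≤ 1 := Real.exp_le_one_iff.2 (by linarith)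
      have h2 := Real.add_one_le_exp (x ^ 2)
      nlinarith

theorem exp_mul_le_of_mem_Icc {p y : ℝ} (h0 : 0 ≤ p) (h1 : p ≤ 1) :
    Real.exp (p * y) ≤ 1 + p * (Real.exp y - 1) := by
  have := convexOn_exp.2 (Set.mem_univ 0) (Set.mem_univ y) (sub_nonneg.2 h1) h0 (by ring)
  simp only [smul_eq_mul, mul_zero, zero_add, Real.exp_zero, mul_one] at this
  linarith

section SubGaussian

variable {Ω : Type*} {m0 : MeasurableSpace Ω} {P : Measure Ω}

/-- For θ² ≤ ι the zero mean removes the first-order term, and convexity lowers the exponent θ²ξ² to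
ιξ². For larger θ, Young's inequality θξ ≤ θ²/ι + ιξ² suffices, because the constant C is then at
most exp(Cθ²/ι). -/
theorem lintegral_exp_mul_le [IsProbabilityMeasure P] {ξ : Ω → ℝ} {ι C : ℝ} (hξ : Measurable ξ) (hι : 0 < ι) (hC : 1 ≤ C)
    (hint : Integrable ξ P) (hmean : ∫ ω, ξ ω ∂P = 0)
    (hsub : ∫⁻ ω, ENNReal.ofReal (Real.exp (ι * ξ ω ^ 2)) ∂P ≤ ENNReal.ofReal C) (θ : ℝ) :
    ∫⁻ ω, ENNReal.ofReal (Real.exp (θ * ξ ω)) ∂P ≤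
      ENNReal.ofReal (Real.exp ((1 + C) / ι * θ ^ 2)) := by
  have hi : Integrable (fun ω => Real.exp (ι * ξ ω ^ 2)) P := by
    refine ⟨by fun_prop, ?_⟩
    rw [hasFiniteIntegral_iff_ofReal (Eventually.of_forall fun ω => (Real.exp_pos _).le)]
    exact hsub.trans_lt ENNReal.ofReal_lt_top
  have hb : ∫ ω, Real.exp (ι * ξ ω ^ 2) ∂P ≤ C := by
    rw [← ENNReal.ofReal_le_ofReal_iff (by linarith),
      ofReal_integral_eq_lintegral_ofReal hi (Eventually.of_forall fun ω => (Real.exp_pos _).le)]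
    exact hsub
  obtain ⟨F, hF, hle, hFb⟩ : ∃ F : Ω → ℝ, Integrable F P ∧
      (∀ ω, Real.exp (θ * ξ ω) ≤ F ω) ∧ ∫ ω, F ω ∂P ≤ Real.exp ((1 + C) / ι * θ ^ 2) := by
    rcases le_or_gt (θ ^ 2) ι with hθ | hθ
    · have hp0 : 0 ≤ θ ^ 2 / ι := by positivity
      have hp1 : θ ^ 2 / ι ≤ 1 := div_le_one_of_le₀ hθ hι.le
      refine ⟨fun ω => θ * ξ ω + (1 + θ ^ 2 / ι * (Real.exp (ι * ξ ω ^ 2) - 1)), ?_, ?_, ?_⟩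
      · exact (hint.const_mul θ).add
          ((integrable_const 1).add ((hi.sub (integrable_const 1)).const_mul _))
      · intro ω
        have h1 := exp_le_add_exp_sq (θ * ξ ω)
        have h2 := exp_mul_le_of_mem_Icc (y := ι * ξ ω ^ 2) hp0 hp1
        have h3 : θ ^ 2 / ι * (ι * ξ ω ^ 2) = (θ * ξ ω) ^ 2 := by field_simp
        rw [h3] at h2
        linarith
      · change ∫ ω, θ * ξ ω + (1 + θ ^ 2 / ι * (Real.exp (ι * ξ ω ^ 2) - 1)) ∂P ≤ _
        rw [integral_add (hint.const_mul θ)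
          (g := fun ω => 1 + θ ^ 2 / ι * (Real.exp (ι * ξ ω ^ 2) - 1))
          ((integrable_const 1).add ((hi.sub (integrable_const 1)).const_mul _)),
          integral_add (integrable_const 1)
            (g := fun ω => θ ^ 2 / ι * (Real.exp (ι * ξ ω ^ 2) - 1)) ((hi.sub (integrable_const 1)).const_mul _),
          integral_const_mul, hmean, integral_const_mul,
          integral_sub hi (integrable_const 1)]
        simp only [mul_zero, integral_const, probReal_univ, smul_eq_mul, mul_one, zero_add]
        have h1 := Real.add_one_le_exp ((1 + C) / ι * θ ^ 2)
        have h2 : (1 + C) / ι * θ ^ 2 = θ ^ 2 / ι * (1 + C) := by ring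
        have h3 := mul_le_mul_of_nonneg_left hb hp0
        nlinarith
    · have hp1 : 1 ≤ θ ^ 2 / ι := (one_le_div hι).2 hθ.le
      refine ⟨fun ω => Real.exp (θ ^ 2 / ι) * Real.exp (ι * ξ ω ^ 2), hi.const_mul _, ?_, ?_⟩
      · intro ω
        change _ ≤ Real.exp (θ ^ 2 / ι) * Real.exp (ι * ξ ω ^ 2)
        rw [← Real.exp_add, Real.exp_le_exp]
        have h1 : θ ^ 2 / ι + ι * ξ ω ^ 2 - θ * ξ ω =
            ((θ - ι * ξ ω / 2) ^ 2 + 3 / 4 * (ι * ξ ω) ^ 2) / ι := by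
          field_simp
          ring
        have h2 : 0 ≤ ((θ - ι * ξ ω / 2) ^ 2 + 3 / 4 * (ι * ξ ω) ^ 2) / ι := by positivity
        linarith
      · rw [integral_const_mul]
        have h2 : (1 + C) / ι * θ ^ 2 = θ ^ 2 / ι + C * (θ ^ 2 / ι) := by ring
        rw [h2, Real.exp_add]
        gcongr
        have h3 := Real.add_one_le_exp (C * (θ ^ 2 / ι))
        nlinarith
  calc _ ≤ ∫⁻ ω, ENNReal.ofReal (F ω) ∂P :=
        lintegral_mono fun ω => ENNReal.ofReal_le_ofReal (hle ω)
    _ = ENNReal.ofReal (∫ ω, F ω ∂P) :=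
        (ofReal_integral_eq_lintegral_ofReal hF
          (Eventually.of_forall fun ω => (Real.exp_pos _).le.trans (hle ω))).symm
    _ ≤ _ := ENNReal.ofReal_le_ofReal hFb

/-- Cauchy–Schwarz followed by Jensen with weights c_k/a; the unused weight is placed at 0, where
the exponential is 1. -/
theorem exp_sq_sum_le (N : ℕ) {a ι : ℝ} {c : ℕ → ℝ} (hι : 0 < ι) (ha : 0 < a)
    (hc : ∀ k, 0 < c k) (hsum : ∑ k ∈ Finset.range N, c k ≤ a) (z : ℕ → ℝ) :
    Real.exp (ι * ((∑ k ∈ Finset.range N, z k) / a) ^ 2) ≤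
      (1 - ∑ k ∈ Finset.range N, c k / a) +
        ∑ k ∈ Finset.range N, c k / a * Real.exp (ι * (z k / c k) ^ 2) := by
  have hp : ∑ k ∈ Finset.range N, c k / a ≤ 1 := by
    rw [← Finset.sum_div]
    exact div_le_one_of_le₀ hsum ha.le
  have hcs : ((∑ k ∈ Finset.range N, z k) / a) ^ 2 ≤
      ∑ k ∈ Finset.range N, c k / a * (z k / c k) ^ 2 := by
    have h1 : (∑ k ∈ Finset.range N, z k) ^ 2 ≤
        (∑ k ∈ Finset.range N, c k) * ∑ k ∈ Finset.range N, z k ^ 2 / c k := by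
      refine Finset.sum_sq_le_sum_mul_sum_of_sq_le_mul _ (fun k _ => (hc k).le)
        (fun k _ => div_nonneg (sq_nonneg _) (hc k).le) fun k _ => le_of_eq ?_
      have := (hc k).ne'
      field_simp
    have h2 : ∑ k ∈ Finset.range N, c k / a * (z k / c k) ^ 2 =
        (∑ k ∈ Finset.range N, z k ^ 2 / c k) / a := by
      rw [Finset.sum_div]
      refine Finset.sum_congr rfl fun k _ => ?_
      have := (hc k).ne'
      field_simp
    have h3 : 0 ≤ ∑ k ∈ Finset.range N, z k ^ 2 / c k :=
      Finset.sum_nonneg fun k _ => div_nonneg (sq_nonneg _) (hc k).le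
    rw [h2, div_pow, div_le_div_iff₀ (by positivity) ha]
    nlinarith [mul_le_mul_of_nonneg_right hsum h3]
  have hconv := convexOn_exp.map_add_sum_le (t := Finset.range N) (w := fun k => c k / a)
    (p := fun k => ι * (z k / c k) ^ 2) (v := 1 - ∑ k ∈ Finset.range N, c k / a) (q := 0)
    (fun k _ => div_nonneg (hc k).le ha.le) (by ring) (fun _ _ => Set.mem_univ _)
    (by linarith) (Set.mem_univ _)
  simp only [smul_eq_mul, mul_zero, zero_add, Real.exp_zero, mul_one] at hconv
  refine (Real.exp_le_exp.2 ?_).trans hconv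
  calc _ ≤ ι * ∑ k ∈ Finset.range N, c k / a * (z k / c k) ^ 2 := by gcongr
    _ = _ := by
      rw [Finset.mul_sum]
      exact Finset.sum_congr rfl fun k _ => by ring

/-- Sub-Gaussian scales add, without any independence. The bound is uniform over partial sums, and
Fatou's lemma carries it to the limit. -/
theorem lintegral_exp_sq_hasSum_le [IsProbabilityMeasure P] {ζ : ℕ → Ω → ℝ} {X : Ω → ℝ} {c : ℕ → ℝ} {a ι C : ℝ}
    (hι : 0 < ι) (ha : 0 < a) (hC : 1 ≤ C) (hc : ∀ k, 0 < c k)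
    (hsum : ∀ N, ∑ k ∈ Finset.range N, c k ≤ a) (hζ : ∀ k, Measurable (ζ k))
    (hsub : ∀ k, ∫⁻ ω, ENNReal.ofReal (Real.exp (ι * (ζ k ω / c k) ^ 2)) ∂P ≤ ENNReal.ofReal C)
    (hX : ∀ᵐ ω ∂P, HasSum (fun k => ζ k ω) (X ω)) :
    ∫⁻ ω, ENNReal.ofReal (Real.exp (ι * (X ω / a) ^ 2)) ∂P ≤ ENNReal.ofReal C := by
  have hfin : ∀ N, ∫⁻ ω, ENNReal.ofReal
      (Real.exp (ι * ((∑ k ∈ Finset.range N, ζ k ω) / a) ^ 2)) ∂P ≤ ENNReal.ofReal C := by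
    intro N
    have hp : ∑ k ∈ Finset.range N, c k / a ≤ 1 := by
      rw [← Finset.sum_div]
      exact div_le_one_of_le₀ (hsum N) ha.le
    have hp0 : ∀ k, 0 ≤ c k / a := fun k => div_nonneg (hc k).le ha.le
    calc _ ≤ ∫⁻ ω, (ENNReal.ofReal (1 - ∑ k ∈ Finset.range N, c k / a) +
          ∑ k ∈ Finset.range N, ENNReal.ofReal (c k / a) *
            ENNReal.ofReal (Real.exp (ι * (ζ k ω / c k) ^ 2))) ∂P := by
          refine lintegral_mono fun ω => ?_
          refine (ENNReal.ofReal_le_ofReal (exp_sq_sum_le N hι ha hc (hsum N) _)).trans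
            (le_of_eq ?_)
          rw [ENNReal.ofReal_add (by linarith) (Finset.sum_nonneg fun k _ =>
            mul_nonneg (hp0 k) (Real.exp_pos _).le), ENNReal.ofReal_sum_of_nonneg fun k _ =>
            mul_nonneg (hp0 k) (Real.exp_pos _).le]
          congr 1
          exact Finset.sum_congr rfl fun k _ => ENNReal.ofReal_mul (hp0 k)
      _ = ENNReal.ofReal (1 - ∑ k ∈ Finset.range N, c k / a) +
          ∑ k ∈ Finset.range N, ENNReal.ofReal (c k / a) *
            ∫⁻ ω, ENNReal.ofReal (Real.exp (ι * (ζ k ω / c k) ^ 2)) ∂P := by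
          rw [lintegral_add_left measurable_const, lintegral_const, measure_univ, mul_one,
            lintegral_finsetSum _ fun k _ => by fun_prop]
          congr 1
          exact Finset.sum_congr rfl fun k _ => lintegral_const_mul _ (by fun_prop)
      _ ≤ ENNReal.ofReal (1 - ∑ k ∈ Finset.range N, c k / a) +
          ∑ k ∈ Finset.range N, ENNReal.ofReal (c k / a) * ENNReal.ofReal C := by
          gcongr with k _
          exact hsub k
      _ = ENNReal.ofReal ((1 - ∑ k ∈ Finset.range N, c k / a) +
          (∑ k ∈ Finset.range N, c k / a) * C) := by
          rw [← Finset.sum_mul, ← ENNReal.ofReal_sum_of_nonneg fun k _ => hp0 k,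
            ← ENNReal.ofReal_mul (Finset.sum_nonneg fun k _ => hp0 k),
            ← ENNReal.ofReal_add (by linarith)]
          exact mul_nonneg (Finset.sum_nonneg fun k _ => hp0 k) (by linarith)
      _ ≤ _ := ENNReal.ofReal_le_ofReal (by nlinarith)
  have hlim : ∀ᵐ ω ∂P, ENNReal.ofReal (Real.exp (ι * (X ω / a) ^ 2)) = liminf (fun N =>
      ENNReal.ofReal (Real.exp (ι * ((∑ k ∈ Finset.range N, ζ k ω) / a) ^ 2))) atTop := by
    filter_upwards [hX] with ω hω
    refine (Tendsto.liminf_eq ?_).symm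
    have hcont : Continuous fun y : ℝ => ENNReal.ofReal (Real.exp (ι * (y / a) ^ 2)) :=
      ENNReal.continuous_ofReal.comp (by fun_prop)
    exact (hcont.tendsto _).comp hω.tendsto_sum_nat
  rw [lintegral_congr_ae hlim]
  refine (lintegral_liminf_le fun N => ?_).trans ?_
  · have := Finset.measurable_sum (Finset.range N) fun k _ => hζ k
    fun_prop
  · exact liminf_le_of_le (by isBoundedDefault) fun b hb => by
      obtain ⟨N, hN⟩ := hb.exists
      exact hN.trans (hfin N)

/-- An exponential moment bound for sums of predictable bounded multiples of independent
sub-Gaussian innovations. -/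
theorem lintegral_exp_predictable_sum_le [IsProbabilityMeasure P] {F : ℕ → MeasurableSpace Ω}
    (hF : Monotone F) (hFm : ∀ t, F t ≤ m0) {Y ξ : ℕ → Ω → ℝ}
    (hY : ∀ t, Measurable[F t] (Y t)) (hξ : ∀ t, Measurable[F (t + 1)] (ξ t)) {n : ℕ}
    (hind : ∀ t < n, Indep (F t) (MeasurableSpace.comap (ξ t) inferInstance) P)
    {b V : ℝ} (hV : 0 ≤ V) (hb : ∀ t ω, |Y t ω| ≤ b)
    (hmgf : ∀ t < n, ∀ θ : ℝ, ∫⁻ ω, ENNReal.ofReal (Real.exp (θ * ξ t ω)) ∂P ≤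
      ENNReal.ofReal (Real.exp (V * θ ^ 2)))
    (w : ℕ → ℝ) (θ : ℝ) :
    ∫⁻ ω, ENNReal.ofReal (Real.exp (θ * ∑ t ∈ Finset.range n, w t * Y t ω * ξ t ω)) ∂P ≤
      ENNReal.ofReal (Real.exp (V * θ ^ 2 * b ^ 2 * ∑ t ∈ Finset.range n, w t ^ 2)) := by
  induction n with
  | zero => simp
  | succ n ih =>
    have ih' := ih (fun t ht => hind t (by omega)) (fun t ht => hmgf t (by omega))
    set S : Ω → ℝ := fun ω => ∑ t ∈ Finset.range n, w t * Y t ω * ξ t ω with hS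
    have hSm : Measurable[F n] S := by
      refine Finset.measurable_sum _ fun t ht => ?_
      have ht := Finset.mem_range.1 ht
      have h1 : Measurable[F n] (Y t) := (hY t).mono (hF (by omega)) le_rfl
      have h2 : Measurable[F n] (ξ t) := (hξ t).mono (hF (by omega)) le_rfl
      exact (h1.const_mul (w t)).mul h2
    have hpair : Measurable[F n] fun ω => (S ω, Y n ω) := hSm.prodMk (hY n)
    have hξm : Measurable (ξ n) := (hξ n).mono (hFm _) le_rfl
    have hpm : Measurable fun ω => (S ω, Y n ω) := hpair.mono (hFm n) le_rfl
    have hindep : IndepFun (fun ω => (S ω, Y n ω)) (ξ n) P := by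
      rw [IndepFun_iff_Indep]
      exact indep_of_indep_of_le_left (hind n (by omega)) hpair.comap_le
    -- The joint law factors, so Fubini can integrate the last innovation with the past held fixed,
    -- replacing a conditional expectation.
    have hmap := (indepFun_iff_map_prod_eq_prod_map_map hpm.aemeasurable hξm.aemeasurable).1 hindep
    have hG : Measurable fun q : (ℝ × ℝ) × ℝ =>
        ENNReal.ofReal (Real.exp (θ * (q.1.1 + w n * q.1.2 * q.2))) := by fun_prop
    have hVb : ∀ ω, V * (θ * w n * Y n ω) ^ 2 ≤ V * θ ^ 2 * b ^ 2 * w n ^ 2 := by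
      intro ω
      have h1 : Y n ω ^ 2 ≤ b ^ 2 := sq_le_sq.2 ((hb n ω).trans (le_abs_self b))
      have h2 : 0 ≤ V * (θ * w n) ^ 2 := by positivity
      nlinarith [mul_le_mul_of_nonneg_left h1 h2]
    have : IsProbabilityMeasure (Measure.map (ξ n) P) :=
      Measure.isProbabilityMeasure_map hξm.aemeasurable
    calc ∫⁻ ω, ENNReal.ofReal
          (Real.exp (θ * ∑ t ∈ Finset.range (n + 1), w t * Y t ω * ξ t ω)) ∂P
        = ∫⁻ ω, ENNReal.ofReal (Real.exp (θ * (S ω + w n * Y n ω * ξ n ω))) ∂P := by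
          refine lintegral_congr fun ω => ?_
          rw [Finset.sum_range_succ]
      _ = ∫⁻ q, ENNReal.ofReal (Real.exp (θ * (q.1.1 + w n * q.1.2 * q.2)))
            ∂(Measure.map (fun ω => ((S ω, Y n ω), ξ n ω)) P) :=
          (lintegral_map hG (hpm.prodMk hξm)).symm
      _ = ∫⁻ ω, ∫⁻ ω', ENNReal.ofReal
            (Real.exp (θ * (S ω + w n * Y n ω * ξ n ω'))) ∂P ∂P := by
          rw [hmap, lintegral_prod _ hG.aemeasurable,
            lintegral_map hG.lintegral_prod_right' hpm]
          refine lintegral_congr fun ω => ?_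
          exact lintegral_map (by fun_prop) hξm
      _ ≤ ∫⁻ ω, ENNReal.ofReal (Real.exp (θ * S ω)) *
            ENNReal.ofReal (Real.exp (V * θ ^ 2 * b ^ 2 * w n ^ 2)) ∂P := by
          refine lintegral_mono fun ω => ?_
          calc _ = ∫⁻ ω', ENNReal.ofReal (Real.exp (θ * S ω)) *
                ENNReal.ofReal (Real.exp (θ * w n * Y n ω * ξ n ω')) ∂P := by
                refine lintegral_congr fun ω' => ?_
                rw [← ENNReal.ofReal_mul (Real.exp_pos _).le, ← Real.exp_add]
                congr 2
                ring
            _ = ENNReal.ofReal (Real.exp (θ * S ω)) *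
                ∫⁻ ω', ENNReal.ofReal (Real.exp (θ * w n * Y n ω * ξ n ω')) ∂P :=
                lintegral_const_mul _ (by fun_prop)
            _ ≤ _ := by
                gcongr
                refine (hmgf n (by omega) _).trans (ENNReal.ofReal_le_ofReal ?_)
                exact Real.exp_le_exp.2 (hVb ω)
      _ = (∫⁻ ω, ENNReal.ofReal (Real.exp (θ * S ω)) ∂P) *
            ENNReal.ofReal (Real.exp (V * θ ^ 2 * b ^ 2 * w n ^ 2)) := by
          have hSm' : Measurable S := hSm.mono (hFm n) le_rfl
          exact lintegral_mul_const _ (by fun_prop)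
      _ ≤ ENNReal.ofReal (Real.exp (V * θ ^ 2 * b ^ 2 * ∑ t ∈ Finset.range n, w t ^ 2)) *
            ENNReal.ofReal (Real.exp (V * θ ^ 2 * b ^ 2 * w n ^ 2)) := by gcongr
      _ = _ := by
          rw [← ENNReal.ofReal_mul (Real.exp_pos _).le, ← Real.exp_add, Finset.sum_range_succ,
            mul_add]

theorem measure_lt_le_of_lintegral_exp_le {Z : Ω → ℝ} (hZ : Measurable Z) {g C : ℝ}
    (h : ∫⁻ ω, ENNReal.ofReal (Real.exp (Z ω)) ∂P ≤ ENNReal.ofReal C) :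
    P {ω | g < Z ω} ≤ ENNReal.ofReal (C * Real.exp (-g)) := by
  have hm := mul_meas_ge_le_lintegral (μ := P)
    (f := fun ω => ENNReal.ofReal (Real.exp (Z ω))) (by fun_prop) (ENNReal.ofReal (Real.exp g))
  have hsub : P {ω | g < Z ω} ≤
      P {ω | ENNReal.ofReal (Real.exp g) ≤ ENNReal.ofReal (Real.exp (Z ω))} :=
    measure_mono fun ω hω => ENNReal.ofReal_le_ofReal (Real.exp_le_exp.2 (le_of_lt hω))
  calc _ ≤ P {ω | ENNReal.ofReal (Real.exp g) ≤ ENNReal.ofReal (Real.exp (Z ω))} := hsub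
    _ = ENNReal.ofReal (Real.exp (-g)) * (ENNReal.ofReal (Real.exp g) *
        P {ω | ENNReal.ofReal (Real.exp g) ≤ ENNReal.ofReal (Real.exp (Z ω))}) := by
      rw [← mul_assoc, ← ENNReal.ofReal_mul (Real.exp_pos _).le, ← Real.exp_add]
      simp
    _ ≤ ENNReal.ofReal (Real.exp (-g)) * ENNReal.ofReal C := by
      gcongr
      exact hm.trans h
    _ = _ := by rw [← ENNReal.ofReal_mul (Real.exp_pos _).le, mul_comm]

/-- The two-sided sub-Gaussian tail bound. -/
theorem measure_lt_abs_le_of_mgf_le {Z : Ω → ℝ} (hZ : Measurable Z) {v g : ℝ} (hv : 0 < v) (hg : 0 < g)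
    (h : ∀ θ : ℝ, ∫⁻ ω, ENNReal.ofReal (Real.exp (θ * Z ω)) ∂P ≤
      ENNReal.ofReal (Real.exp (v * θ ^ 2))) :
    P {ω | g < |Z ω|} ≤ ENNReal.ofReal (2 * Real.exp (-(g ^ 2 / (4 * v)))) := by
  -- The value g/(2v) minimises the Chernoff exponent vθ² - θg.
  have hθ : 0 < g / (2 * v) := by positivity
  have hone : ∀ σ : ℝ, σ ^ 2 = 1 → P {ω | g < σ * Z ω} ≤
      ENNReal.ofReal (Real.exp (-(g ^ 2 / (4 * v)))) := by
    intro σ hσ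
    have h1 := measure_lt_le_of_lintegral_exp_le (P := P) (Z := fun ω => g / (2 * v) * σ * Z ω)
      (by fun_prop) (g := g / (2 * v) * g) (h _)
    rw [mul_pow, hσ, mul_one, ← Real.exp_add] at h1
    have h2 : v * (g / (2 * v)) ^ 2 + -(g / (2 * v) * g) = -(g ^ 2 / (4 * v)) := by
      field_simp
      ring
    rw [h2] at h1
    refine (measure_mono fun ω hω => ?_).trans h1
    have hω : g < σ * Z ω := hω
    change g / (2 * v) * g < g / (2 * v) * σ * Z ω
    rw [mul_assoc]
    exact mul_lt_mul_of_pos_left hω hθ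
  calc P {ω | g < |Z ω|} ≤ P ({ω | g < 1 * Z ω} ∪ {ω | g < -1 * Z ω}) := by
        refine measure_mono fun ω hω => ?_
        rcases lt_abs.1 (show g < |Z ω| from hω) with h' | h'
        · exact Or.inl (show g < 1 * Z ω by linarith)
        · exact Or.inr (show g < -1 * Z ω by linarith)
    _ ≤ _ := (measure_union_le _ _).trans (add_le_add (hone 1 (by norm_num))
        (hone (-1) (by norm_num)))
    _ = _ := by
      rw [← ENNReal.ofReal_add (Real.exp_pos _).le (Real.exp_pos _).le, two_mul]

end SubGaussian

/-! ### Matrix norms -/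

section Norms

variable {d : ℕ}

theorem opNorm_mul_le (M N : Matrix (Fin d) (Fin d) ℝ) : opNorm (M * N) ≤ opNorm M * opNorm N := by
  rw [opNorm, map_mul]
  exact norm_mul_le _ _

/-- A row is the adjoint applied to a basis vector, and the adjoint has the same norm. -/
theorem l2Norm_row_le (M : Matrix (Fin d) (Fin d) ℝ) (j : Fin d) : l2Norm (M j) ≤ opNorm M := by
  have h1 : opNorm M = ‖Matrix.toEuclideanCLM (n := Fin d) (𝕜 := ℝ) (star M)‖ := by
    rw [map_star]
    exact (norm_star (E := EuclideanSpace ℝ (Fin d) →L[ℝ] EuclideanSpace ℝ (Fin d)) _).symm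
  have h2 := (Matrix.toEuclideanCLM (n := Fin d) (𝕜 := ℝ) (star M)).le_opNorm
    (WithLp.toLp 2 (Pi.single j 1))
  have h3 : ‖WithLp.toLp 2 (Pi.single j (1 : ℝ) : Fin d → ℝ)‖ = 1 := by simp
  have h4 : Matrix.mulVec (star M) (Pi.single j 1) = M j := by
    funext l
    simp [Matrix.star_eq_conjTranspose]
  rw [h3, mul_one, Matrix.toEuclideanCLM_toLp, h4] at h2
  rw [h1]
  exact h2

theorem opNorm_sqrt_sq {S : Matrix (Fin d) (Fin d) ℝ} (hS : S.PosSemidef) :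
    opNorm (CFC.sqrt S) ^ 2 = opNorm S := by
  have h0 : 0 ≤ S := Matrix.nonneg_iff_posSemidef.2 hS
  have hsa : star (CFC.sqrt S) = CFC.sqrt S := (CFC.sqrt_nonneg S).isSelfAdjoint
  have h1 : star (CFC.sqrt S) * CFC.sqrt S = S := by
    rw [hsa, CFC.sqrt_mul_sqrt_self S h0]
  conv_rhs => rw [← h1]
  rw [opNorm, opNorm, map_mul, map_star, sq]
  exact (CStarRing.norm_star_mul_self
    (E := EuclideanSpace ℝ (Fin d) →L[ℝ] EuclideanSpace ℝ (Fin d))).symm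

theorem opNorm_nonneg (M : Matrix (Fin d) (Fin d) ℝ) : 0 ≤ opNorm M := norm_nonneg _

theorem l2Norm_smul (c : ℝ) (v : Fin d → ℝ) : l2Norm (c • v) = |c| * l2Norm v := by
  rw [l2Norm, WithLp.toLp_smul, norm_smul, Real.norm_eq_abs, l2Norm]

end Norms

/-! ### Sub-Gaussian states and innovations -/

section Model

variable {Ω : Type*} {m0 : MeasurableSpace Ω} {P : Measure Ω} {n d : ℕ}
  {A Sig : ℝ → Matrix (Fin d) (Fin d) ℝ} {ε X : ℤ → Ω → Fin d → ℝ} {C₁ ρ D Cσ ι₁ C₀ : ℝ}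

theorem l2Norm_single (i : Fin d) : l2Norm (Pi.single i (1 : ℝ)) = 1 := by
  simp [l2Norm]

theorem l2Norm_eq_zero {v : Fin d → ℝ} (h : l2Norm v = 0) : v = 0 := by
  simpa [l2Norm] using h

theorem ModelConditions.one_le_const [IsProbabilityMeasure P] (hC : ModelConditions P n A Sig ε C₁ ρ D Cσ ι₁ C₀)
    (hι : 0 < ι₁) (i : Fin d) : 1 ≤ C₀ := by
  have h1 := hC.subGaussian 0 (Pi.single i 1) (l2Norm_single i)
  have h2 : (1 : ENNReal) ≤
      ∫⁻ ω, ENNReal.ofReal (Real.exp (ι₁ * (Pi.single i 1 ⬝ᵥ ε 0 ω) ^ 2)) ∂P := by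
    calc (1 : ENNReal) = ∫⁻ _, 1 ∂P := by simp
      _ ≤ _ := lintegral_mono fun ω => ENNReal.one_le_ofReal.2 (Real.one_le_exp (by positivity))
  exact ENNReal.one_le_ofReal.1 (h2.trans h1)

theorem ModelConditions.lintegral_exp_sq_dotProduct_le [IsProbabilityMeasure P]
    (hC : ModelConditions P n A Sig ε C₁ ρ D Cσ ι₁ C₀) (hι : 0 < ι₁) (hC₀ : 1 ≤ C₀) (t : ℤ)
    {u : Fin d → ℝ} {c : ℝ} (hc : 0 < c) (hu : l2Norm u ≤ c) :
    ∫⁻ ω, ENNReal.ofReal (Real.exp (ι₁ * (u ⬝ᵥ ε t ω / c) ^ 2)) ∂P ≤ ENNReal.ofReal C₀ := by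
  have hnn : 0 ≤ l2Norm u := norm_nonneg _
  rcases hnn.eq_or_lt with h0 | hpos
  · rw [l2Norm_eq_zero h0.symm]
    simpa using hC₀
  · refine le_trans (lintegral_mono fun ω => ?_)
      (hC.subGaussian t ((l2Norm u)⁻¹ • u) ?_)
    · refine ENNReal.ofReal_le_ofReal (Real.exp_le_exp.2 ?_)
      rw [smul_dotProduct, smul_eq_mul, div_eq_mul_inv, mul_comm (u ⬝ᵥ ε t ω), mul_pow, mul_pow]
      have : c⁻¹ ^ 2 ≤ (l2Norm u)⁻¹ ^ 2 := by gcongr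
      gcongr
    · rw [l2Norm_smul, abs_of_pos (inv_pos.2 hpos), inv_mul_cancel₀ hpos.ne']

/-- The added 1 keeps the scale strictly positive even when `Cσ` is zero, so later divisions are
safe. -/
theorem ModelConditions.opNorm_sqrt_le (hC : ModelConditions P n A Sig ε C₁ ρ D Cσ ι₁ C₀)
    {τ : ℝ} (hτ : τ ≤ 1) : opNorm (CFC.sqrt (Sig τ)) ≤ Real.sqrt (Cσ + 1) := by
  have hpsd : (Sig τ).PosSemidef := by
    rcases lt_or_ge τ 0 with h | h
    · exact hC.volatility_posSemidef τ h
    · exact (hC.volatility_posDef τ ⟨h, hτ⟩).posSemidef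
  refine Real.le_sqrt_of_sq_le ?_
  rw [opNorm_sqrt_sq hpsd]
  linarith [hC.volatility_bound τ hτ]

theorem ModelConditions.volatility_const_nonneg
    (hC : ModelConditions P n A Sig ε C₁ ρ D Cσ ι₁ C₀) : 0 ≤ Cσ :=
  (opNorm_nonneg _).trans (hC.volatility_bound 0 zero_le_one)

theorem scaledTime_le_one (hn : 0 < n) {t : ℤ} (ht : t ≤ n) : scaledTime n t ≤ 1 := by
  have h1 : (t : ℝ) ≤ n := by exact_mod_cast ht
  exact div_le_one_of_le₀ h1 (by positivity)

theorem ModelConditions.one_le_wold_const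
    (hC : ModelConditions P n A Sig ε C₁ ρ D Cσ ι₁ C₀) (i : Fin d) : 1 ≤ C₁ := by
  have h1 := hC.wold_decay 0 le_rfl (by positivity) 0
  have h2 := l2Norm_row_le (1 : Matrix (Fin d) (Fin d) ℝ) i
  have h3 : (1 : Matrix (Fin d) (Fin d) ℝ) i = Pi.single i 1 := by
    funext j
    rw [Matrix.one_eq_pi_single]
  rw [h3, l2Norm_single] at h2
  rw [pow_zero, mul_one] at h1
  exact h2.trans h1

/-- The sub-Gaussian scale of the coordinates of the process. -/
noncomputable def stateScale (C₁ ρ Cσ : ℝ) : ℝ := C₁ * Real.sqrt (Cσ + 1) / (1 - ρ)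

theorem mulVec_innovation (M : Matrix (Fin d) (Fin d) ℝ) (t : ℤ) (ω : Ω) (j : Fin d) :
    Matrix.mulVec M (innovation n Sig ε t ω) j =
      (M * CFC.sqrt (Sig (scaledTime n t))) j ⬝ᵥ ε t ω := by
  rw [innovation, Matrix.mulVec_mulVec]
  rfl

theorem measurable_dotProduct_noise (hM : IsModel P n A Sig ε X) (u : Fin d → ℝ) (t : ℤ) :
    Measurable fun ω => u ⬝ᵥ ε t ω := by
  have := hM.measurable_noise t
  simp only [dotProduct]
  fun_prop

theorem stateScale_pos (hρ₁ : ρ < 1) (hC₁ : 1 ≤ C₁) (hCσ : 0 ≤ Cσ) : 0 < stateScale C₁ ρ Cσ := by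
  have : 0 < 1 - ρ := by linarith
  rw [stateScale]
  positivity

/-- The k-th term of the moving average is a linear form in the noise with coefficient norm at most
C₁√(Cσ+1)ρ^k; the geometric series sums to `stateScale`. -/
theorem lintegral_exp_sq_state_le [IsProbabilityMeasure P] (hM : IsModel P n A Sig ε X)
    (hC : ModelConditions P n A Sig ε C₁ ρ D Cσ ι₁ C₀) (hρ₀ : 0 < ρ) (hρ₁ : ρ < 1) (hι : 0 < ι₁)
    (hn : 0 < n) {t : ℤ} (ht0 : 0 ≤ t) (htn : t ≤ n) (j : Fin d) :
    ∫⁻ ω, ENNReal.ofReal (Real.exp (ι₁ * (X t ω j / stateScale C₁ ρ Cσ) ^ 2)) ∂P ≤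
      ENNReal.ofReal C₀ := by
  have hC₀ := hC.one_le_const hι j
  have hC₁ := hC.one_le_wold_const j
  have hCσ := hC.volatility_const_nonneg
  have hσ : 0 < Real.sqrt (Cσ + 1) := Real.sqrt_pos.2 (by linarith)
  refine lintegral_exp_sq_hasSum_le
    (ζ := fun k ω => Matrix.mulVec (wold n A t k) (innovation n Sig ε (t - k) ω) j)
    (c := fun k => C₁ * Real.sqrt (Cσ + 1) * ρ ^ k) hι (stateScale_pos hρ₁ hC₁ hCσ) hC₀
    (fun k => by positivity) (fun N => ?_) (fun k => ?_) (fun k => ?_) ?_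
  · rw [← Finset.mul_sum, stateScale, div_eq_mul_inv]
    gcongr
    rw [← tsum_geometric_of_lt_one hρ₀.le hρ₁]
    exact (summable_geometric_of_lt_one hρ₀.le hρ₁).sum_le_tsum _ fun k _ => by positivity
  · simp only [mulVec_innovation]
    exact measurable_dotProduct_noise hM _ _
  · simp only [mulVec_innovation]
    refine hC.lintegral_exp_sq_dotProduct_le hι hC₀ _ (by positivity) ?_
    calc _ ≤ opNorm (wold n A t k) * opNorm (CFC.sqrt (Sig (scaledTime n (t - k)))) :=
          (l2Norm_row_le _ j).trans (opNorm_mul_le _ _)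
      _ ≤ (C₁ * ρ ^ k) * Real.sqrt (Cσ + 1) :=
          mul_le_mul (hC.wold_decay t ht0 htn k)
            (hC.opNorm_sqrt_le (scaledTime_le_one hn (by omega))) (opNorm_nonneg _) (by positivity)
      _ = _ := by ring
  · filter_upwards [hM.moving_average t ht0 htn] with ω hω
    exact Pi.hasSum.1 hω j

theorem integrable_noise [IsProbabilityMeasure P] (hM : IsModel P n A Sig ε X) (t : ℤ) (i : Fin d) :
    Integrable (fun ω => ε t ω i) P := by
  have hm : Measurable fun ω => ε t ω i := (measurable_pi_apply i).comp (hM.measurable_noise t)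
  have hsq : Integrable (fun ω => ε t ω i ^ 2) P := by
    -- A non-integrable function has Bochner integral 0, so unit variance already implies square
    -- integrability.
    refine Integrable.of_integral_ne_zero ?_
    have := hM.noise_cov t i i
    rw [Matrix.one_apply_eq] at this
    simp only [sq, this]
    norm_num
  exact ((memLp_two_iff_integrable_sq hm.aestronglyMeasurable).2 hsq).integrable one_le_two

theorem lintegral_exp_innovation_le [IsProbabilityMeasure P] (hM : IsModel P n A Sig ε X)
    (hC : ModelConditions P n A Sig ε C₁ ρ D Cσ ι₁ C₀) (hι : 0 < ι₁)
    (hn : 0 < n) {t : ℤ} (htn : t ≤ n) (i : Fin d) (θ : ℝ) :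
    ∫⁻ ω, ENNReal.ofReal (Real.exp (θ * innovation n Sig ε t ω i)) ∂P ≤
      ENNReal.ofReal (Real.exp ((1 + C₀) / ι₁ * (Cσ + 1) * θ ^ 2)) := by
  have hC₀ := hC.one_le_const hι i
  have hCσ := hC.volatility_const_nonneg
  have hσ : 0 < Real.sqrt (Cσ + 1) := Real.sqrt_pos.2 (by linarith)
  set u := CFC.sqrt (Sig (scaledTime n t)) i with hu
  have hul : l2Norm u ≤ Real.sqrt (Cσ + 1) :=
    (l2Norm_row_le _ i).trans (hC.opNorm_sqrt_le (scaledTime_le_one hn htn))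
  have hint : Integrable (fun ω => u ⬝ᵥ ε t ω) P :=
    integrable_finsetSum _ fun j _ => (integrable_noise hM t j).const_mul _
  have hmean : ∫ ω, u ⬝ᵥ ε t ω ∂P = 0 := by
    simp only [dotProduct]
    rw [integral_finsetSum _ fun j _ => (integrable_noise hM t j).const_mul _]
    simp [integral_const_mul, hM.noise_mean]
  have key := lintegral_exp_mul_le (P := P)
    (ξ := fun ω => u ⬝ᵥ ε t ω / Real.sqrt (Cσ + 1))
    ((measurable_dotProduct_noise hM u t).div_const _) hι hC₀ (hint.div_const _)
    (by rw [integral_div, hmean, zero_div])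
    (hC.lintegral_exp_sq_dotProduct_le hι hC₀ t hσ hul) (θ * Real.sqrt (Cσ + 1))
  have h1 : ∀ ω, θ * Real.sqrt (Cσ + 1) * (u ⬝ᵥ ε t ω / Real.sqrt (Cσ + 1)) =
      θ * innovation n Sig ε t ω i := by
    intro ω
    have : innovation n Sig ε t ω i = u ⬝ᵥ ε t ω := rfl
    rw [this]
    field_simp
  have h2 : (1 + C₀) / ι₁ * (θ * Real.sqrt (Cσ + 1)) ^ 2 =
      (1 + C₀) / ι₁ * (Cσ + 1) * θ ^ 2 := by
    rw [mul_pow, Real.sq_sqrt (by linarith)]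
    ring
  simpa only [h1, h2] using key

/-! ### The natural filtration -/

/-- The σ-algebra generated by the noise up to time `t`. -/
abbrev past (ε : ℤ → Ω → Fin d → ℝ) (t : ℤ) : MeasurableSpace Ω :=
  ⨆ s ∈ Set.Iic t, MeasurableSpace.comap (ε s) inferInstance

theorem past_mono : Monotone (past ε) := fun _ _ hst =>
  biSup_mono fun _ hs => le_trans (Set.mem_Iic.1 hs) hst

theorem past_le (hM : IsModel P n A Sig ε X) (t : ℤ) : past ε t ≤ m0 :=
  iSup₂_le fun s _ => (hM.measurable_noise s).comap_le

theorem measurable_noise_past {s t : ℤ} (hst : s ≤ t) : Measurable[past ε t] (ε s) :=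
  Measurable.of_comap_le (le_iSup₂_of_le s hst le_rfl)

theorem measurable_dotProduct_past {s t : ℤ} (hst : s ≤ t) (u : Fin d → ℝ) :
    Measurable[past ε t] fun ω => u ⬝ᵥ ε s ω :=
  Finset.measurable_sum _ fun j _ =>
    ((measurable_pi_apply j).comp (measurable_noise_past hst)).const_mul (u j)

theorem indep_past_noise (hM : IsModel P n A Sig ε X) (t : ℤ) :
    Indep (past ε t) (MeasurableSpace.comap (ε (t + 1)) inferInstance) P := by
  have h := indep_iSup_of_disjoint (fun s => (hM.measurable_noise s).comap_le)
    hM.indep_noise (S := Set.Iic t) (T := {t + 1}) (by simp)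
  simpa [past] using h

theorem indep_past_innovation (hM : IsModel P n A Sig ε X) (t : ℤ) (i : Fin d) :
    Indep (past ε t) (MeasurableSpace.comap
      (fun ω => innovation n Sig ε (t + 1) ω i) inferInstance) P := by
  refine indep_of_indep_of_le_right (indep_past_noise hM t) ?_
  have : (fun ω => innovation n Sig ε (t + 1) ω i) =
      (fun v : Fin d → ℝ => CFC.sqrt (Sig (scaledTime n (t + 1 : ℤ))) i ⬝ᵥ v) ∘ ε (t + 1) := rfl
  rw [this, ← MeasurableSpace.comap_comp]
  refine MeasurableSpace.comap_mono (Measurable.comap_le ?_)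
  simp only [dotProduct]
  fun_prop

/-- A version of `X_t` which is adapted to the natural filtration of the noise. -/
noncomputable def adaptedState (n : ℕ) (A Sig : ℝ → Matrix (Fin d) (Fin d) ℝ)
    (ε : ℤ → Ω → Fin d → ℝ) (t : ℤ) (j : Fin d) (ω : Ω) : ℝ :=
  limsup (fun N : ℕ => ∑ k ∈ Finset.range N,
    Matrix.mulVec (wold n A t k) (innovation n Sig ε (t - k) ω) j) atTop

/-- A limsup is measurable whether or not the series converges. The state `X t` itself is only
almost surely equal to the series and need not be measurable for the past. -/
theorem measurable_adaptedState (t : ℤ) (j : Fin d) :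
    Measurable[past ε t] (adaptedState n A Sig ε t j) := by
  have hk : ∀ k : ℕ, Measurable[past ε t] fun ω =>
      Matrix.mulVec (wold n A t k) (innovation n Sig ε (t - k) ω) j := fun k => by
    simp only [mulVec_innovation]
    exact measurable_dotProduct_past (by omega) _
  exact Measurable.limsup fun N => Finset.measurable_sum _ fun k _ => hk k

theorem adaptedState_ae_eq (hM : IsModel P n A Sig ε X) {t : ℤ} (ht0 : 0 ≤ t) (htn : t ≤ n) :
    ∀ᵐ ω ∂P, ∀ j, adaptedState n A Sig ε t j ω = X t ω j := by
  filter_upwards [hM.moving_average t ht0 htn] with ω hω j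
  exact (Pi.hasSum.1 hω j).tendsto_sum_nat.limsup_eq

/-- Truncation at level `b`. -/
noncomputable def truncate (b y : ℝ) : ℝ := Set.indicator {y | |y| ≤ b} id y

theorem measurable_truncate (b : ℝ) : Measurable (truncate b) :=
  measurable_id.indicator (measurableSet_le (by fun_prop) (by fun_prop))

theorem abs_truncate_le {b : ℝ} (hb : 0 ≤ b) (y : ℝ) : |truncate b y| ≤ b := by
  by_cases hy : |y| ≤ b
  · have : truncate b y = y := Set.indicator_of_mem (s := {y | |y| ≤ b}) hy id
    rwa [this]
  · have : truncate b y = 0 := Set.indicator_of_notMem (s := {y | |y| ≤ b}) hy id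
    rwa [this, abs_zero]

theorem truncate_eq {b y : ℝ} (hy : |y| ≤ b) : truncate b y = y :=
  Set.indicator_of_mem (s := {y | |y| ≤ b}) hy id

/-- The noise score, with truncated regressors. -/
noncomputable def truncScore (n : ℕ) (A Sig : ℝ → Matrix (Fin d) (Fin d) ℝ)
    (ε : ℤ → Ω → Fin d → ℝ) (b : ℝ) (w : ℕ → ℝ) (i j : Fin d) (ω : Ω) : ℝ :=
  ∑ t ∈ Finset.range n, w (t + 1) * truncate b (adaptedState n A Sig ε t j ω) *
    innovation n Sig ε (t + 1) ω i

theorem measurable_truncScore (hM : IsModel P n A Sig ε X) (b : ℝ) (w : ℕ → ℝ) (i j : Fin d) :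
    Measurable (truncScore n A Sig ε b w i j) := by
  refine Finset.measurable_sum _ fun t _ => ?_
  have h1 : Measurable fun ω => truncate b (adaptedState n A Sig ε t j ω) :=
    (measurable_truncate b).comp ((measurable_adaptedState _ j).mono (past_le hM _) le_rfl)
  exact (h1.const_mul _).mul (measurable_dotProduct_noise hM _ _)

/-- The t-th summand pairs a bounded function of the past at t with the innovation at t + 1, which
is what the predictable-sum bound requires. -/
theorem measure_truncScore_le [IsProbabilityMeasure P] (hM : IsModel P n A Sig ε X)
    (hC : ModelConditions P n A Sig ε C₁ ρ D Cσ ι₁ C₀) (hι : 0 < ι₁) {b g Q : ℝ}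
    (hb : 0 < b) (hg : 0 < g) (hQ : 0 < Q) {w : ℕ → ℝ} (hw : ∑ t ∈ Finset.Icc 1 n, |w t| ^ 2 ≤ Q)
    (i j : Fin d) :
    P {ω | g < |truncScore n A Sig ε b w i j ω|} ≤ ENNReal.ofReal
      (2 * Real.exp (-(g ^ 2 / (4 * ((1 + C₀) / ι₁ * (Cσ + 1) * b ^ 2 * Q))))) := by
  have hC₀ := hC.one_le_const hι i
  have hCσ := hC.volatility_const_nonneg
  have hV : 0 < (1 + C₀) / ι₁ * (Cσ + 1) := by positivity
  refine measure_lt_abs_le_of_mgf_le (measurable_truncScore hM b w i j) (by positivity) hg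
    fun θ => ?_
  refine (lintegral_exp_predictable_sum_le (F := fun t : ℕ => past ε t)
    (Y := fun t ω => truncate b (adaptedState n A Sig ε t j ω))
    (ξ := fun t ω => innovation n Sig ε (t + 1) ω i)
    (fun s t hst => past_mono (by exact_mod_cast hst)) (fun t => past_le hM t)
    (fun t => (measurable_truncate b).comp (measurable_adaptedState _ j))
    (fun t => measurable_dotProduct_past (by push_cast; exact le_rfl) _)
    (fun t _ => indep_past_innovation hM t i) hV.le (fun t ω => abs_truncate_le hb.le _)
    (fun t ht θ => lintegral_exp_innovation_le hM hC hι (by omega) (by omega) i θ)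
    (fun t => w (t + 1)) θ).trans ?_
  refine ENNReal.ofReal_le_ofReal (Real.exp_le_exp.2 ?_)
  have hsum : ∑ t ∈ Finset.range n, w (t + 1) ^ 2 ≤ Q := by
    refine le_trans (le_of_eq ?_) hw
    simp only [sq_abs]
    rw [Finset.range_eq_Ico, Finset.sum_Ico_add' (fun t => w t ^ 2) 0 n 1]
    rfl
  calc _ ≤ (1 + C₀) / ι₁ * (Cσ + 1) * θ ^ 2 * b ^ 2 * Q := by gcongr
    _ = _ := by ring

theorem measure_state_le [IsProbabilityMeasure P] (hM : IsModel P n A Sig ε X)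
    (hC : ModelConditions P n A Sig ε C₁ ρ D Cσ ι₁ C₀) (hρ₀ : 0 < ρ) (hρ₁ : ρ < 1) (hι : 0 < ι₁)
    (hn : 0 < n) {t : ℤ} (ht0 : 0 ≤ t) (htn : t ≤ n) (j : Fin d) {b : ℝ} (hb : 0 ≤ b) :
    P {ω | b < |X t ω j|} ≤ ENNReal.ofReal
      (C₀ * Real.exp (-(ι₁ * (b / stateScale C₁ ρ Cσ) ^ 2))) := by
  have hs := stateScale_pos hρ₁ (hC.one_le_wold_const j) hC.volatility_const_nonneg
  have hX : Measurable fun ω => X t ω j := (measurable_pi_apply j).comp (hM.measurable_state t)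
  refine (measure_mono fun ω hω => ?_).trans (measure_lt_le_of_lintegral_exp_le
    (Z := fun ω => ι₁ * (X t ω j / stateScale C₁ ρ Cσ) ^ 2) (by fun_prop)
    (lintegral_exp_sq_state_le hM hC hρ₀ hρ₁ hι hn ht0 htn j))
  have hω : b < |X t ω j| := hω
  change ι₁ * (b / _) ^ 2 < ι₁ * (X t ω j / _) ^ 2
  rw [div_pow, div_pow, ← sq_abs (X t ω j)]
  gcongr

end Model

/-! ### The high-probability event -/

section GoodPath

variable {Ω : Type*} {m0 : MeasurableSpace Ω} {P : Measure Ω} {n d : ℕ}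
  {A Sig : ℝ → Matrix (Fin d) (Fin d) ℝ} {ε X : ℤ → Ω → Fin d → ℝ} {C₁ ρ D Cσ ι₁ C₀ : ℝ}

/-- At the outcome `ω` the recursion holds, the observations are bounded by `b` and the noise
scores are bounded by `g`. -/
structure GoodPath (n : ℕ) (A Sig : ℝ → Matrix (Fin d) (Fin d) ℝ) (ε X : ℤ → Ω → Fin d → ℝ)
    (K : ℝ → ℝ) (h b g : ℝ) (ω : Ω) : Prop where
  recursion : ∀ t : ℕ, t ∈ Finset.Icc 1 n → X t ω =
    Matrix.mulVec (A (scaledTime n t)) (X ((t : ℤ) - 1) ω) + innovation n Sig ε t ω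
  state_le : ∀ t : ℕ, t ∈ Finset.Icc 1 n → ∀ j, |X ((t : ℤ) - 1) ω j| ≤ b
  score_le : ∀ m : ℕ, m ∈ Finset.Icc 1 n → ∀ k ≤ 1, ∀ i j, |∑ t ∈ Finset.Icc 1 n,
    locWeight n K h (scaledTime n m) k t * X ((t : ℤ) - 1) ω j * innovation n Sig ε t ω i| ≤ g

/-- When the states stay below b, truncation changes nothing, so tail bounds for the truncated score
transfer to the true one. -/
theorem truncScore_eq {b : ℝ} {w : ℕ → ℝ} {i j : Fin d} {ω : Ω}
    (had : ∀ t : ℕ, t ∈ Finset.Icc 1 n →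
      adaptedState n A Sig ε ((t : ℤ) - 1) j ω = X ((t : ℤ) - 1) ω j)
    (hb : ∀ t : ℕ, t ∈ Finset.Icc 1 n → |X ((t : ℤ) - 1) ω j| ≤ b) :
    truncScore n A Sig ε b w i j ω =
      ∑ t ∈ Finset.Icc 1 n, w t * X ((t : ℤ) - 1) ω j * innovation n Sig ε t ω i := by
  have h1 : ∑ t ∈ Finset.Icc 1 n, w t * X ((t : ℤ) - 1) ω j * innovation n Sig ε t ω i =
      ∑ t ∈ Finset.range n, w (t + 1) * X (((t + 1 : ℕ) : ℤ) - 1) ω j *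
        innovation n Sig ε ((t + 1 : ℕ) : ℤ) ω i := by
    rw [Finset.range_eq_Ico, Finset.sum_Ico_add'
      (fun t : ℕ => w t * X ((t : ℤ) - 1) ω j * innovation n Sig ε t ω i) 0 n 1]
    rfl
  rw [h1, truncScore]
  refine Finset.sum_congr rfl fun t ht => ?_
  have ht : t + 1 ∈ Finset.Icc 1 n := by
    rw [Finset.mem_range] at ht
    exact Finset.mem_Icc.2 ⟨by omega, by omega⟩
  have h2 := had _ ht
  have h3 := hb _ ht
  push_cast at h2 h3 ⊢
  rw [add_sub_cancel_right] at h2 h3 ⊢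
  rw [h2, truncate_eq h3]

theorem logMax_pos (hn : 2 ≤ n) (d : ℕ) : 0 < logMax n d := by
  refine Real.log_pos (lt_of_lt_of_le ?_ (le_max_left _ _))
  exact_mod_cast (by omega : 1 < n)

theorem exp_neg_mul_logMax (hn : 0 < n) (d k : ℕ) :
    Real.exp (-(k * logMax n d)) = ((max (n : ℝ) d) ^ k)⁻¹ := by
  have : 0 < max (n : ℝ) d := lt_of_lt_of_le (by exact_mod_cast hn) (le_max_left _ _)
  rw [Real.exp_neg, logMax, ← Real.log_pow, Real.exp_log (by positivity)]

/-- The exponents 3 and 5 beat the nd state events and the 2nd² score events, however d compares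
with n. -/
theorem sum_tail_le (hn : 0 < n) (d : ℕ) {C : ℝ} (hC : 0 ≤ C) :
    n * (d * (C * Real.exp (-(3 * logMax n d)))) +
      n * (2 * (d * (d * (2 * Real.exp (-(5 * logMax n d)))))) ≤ (C + 4) / n := by
  have h3 := exp_neg_mul_logMax hn d 3
  have h5 := exp_neg_mul_logMax hn d 5
  push_cast at h3 h5
  rw [h3, h5]
  set N := max (n : ℝ) d with hN
  have hn1 : (1 : ℝ) ≤ n := by exact_mod_cast hn
  have hnN : (n : ℝ) ≤ N := le_max_left _ _
  have hdN : (d : ℝ) ≤ N := le_max_right _ _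
  have hN1 : 1 ≤ N := hn1.trans hnN
  have hd0 : (0 : ℝ) ≤ d := Nat.cast_nonneg d
  calc _ ≤ N * (N * (C * (N ^ 3)⁻¹)) + N * (2 * (N * (N * (2 * (N ^ 5)⁻¹)))) := by gcongr
    _ = C / N + 4 / N * N⁻¹ := by field_simp; ring
    _ ≤ C / n + 4 / n * 1 := by
        gcongr
        exact inv_le_one_of_one_le₀ hN1
    _ = _ := by ring

/-- The bound for the states on the good event. -/
noncomputable def stateBound (n d : ℕ) (C₁ ρ Cσ ι₁ : ℝ) : ℝ :=
  stateScale C₁ ρ Cσ * Real.sqrt (3 * logMax n d / ι₁)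

/-- The constant in the bound for the scores on the good event. -/
noncomputable def scoreConst (C₁ ρ Cσ ι₁ C₀ B : ℝ) : ℝ :=
  Real.sqrt (180 * ((1 + C₀) / ι₁ * (Cσ + 1)) * stateScale C₁ ρ Cσ ^ 2 * B ^ 2 / ι₁)

/-- Outside a null set, the path is good unless some state exceeds b or some truncated score exceeds
g; a union bound covers both. -/
theorem measure_not_goodPath_le [IsProbabilityMeasure P] (hM : IsModel P n A Sig ε X)
    (hC : ModelConditions P n A Sig ε C₁ ρ D Cσ ι₁ C₀) (hρ₀ : 0 < ρ) (hρ₁ : ρ < 1) (hι : 0 < ι₁)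
    (hn : 2 ≤ n) (hd : 0 < d) {K : ℝ → ℝ} (hK : IsKernel K) {B : ℝ} (hB : ∀ x, K x ≤ B)
    (hB0 : 0 < B) {h : ℝ} (hh : 0 < h) (hnh : 1 ≤ n * h) :
    P {ω | ¬ GoodPath n A Sig ε X K h (stateBound n d C₁ ρ Cσ ι₁)
      (scoreConst C₁ ρ Cσ ι₁ C₀ B * (logMax n d * (Real.sqrt (n * h))⁻¹)) ω} ≤
      ENNReal.ofReal ((C₀ + 4) / n) := by
  have hL := logMax_pos hn d
  have hC₀ := hC.one_le_const hι ⟨0, hd⟩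
  have hCσ := hC.volatility_const_nonneg
  have ha := stateScale_pos hρ₁ (hC.one_le_wold_const ⟨0, hd⟩) hCσ
  have hnh0 : 0 < n * h := by linarith
  have hV : 0 < (1 + C₀) / ι₁ * (Cσ + 1) := by positivity
  set L := logMax n d with hLdef
  set b := stateBound n d C₁ ρ Cσ ι₁ with hb
  set g := scoreConst C₁ ρ Cσ ι₁ C₀ B * (L * (Real.sqrt (n * h))⁻¹) with hg
  set Q := 3 * (n * h) * (B / (n * h)) ^ 2 with hQ
  have hb0 : 0 < b := by rw [hb, stateBound]; positivity
  have hg0 : 0 < g := by rw [hg, scoreConst]; positivity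
  have hQ0 : 0 < Q := by positivity
  have hb2 : b ^ 2 = stateScale C₁ ρ Cσ ^ 2 * (3 * L / ι₁) := by
    rw [hb, stateBound, mul_pow, Real.sq_sqrt (by positivity)]
  have hexp1 : ι₁ * (b / stateScale C₁ ρ Cσ) ^ 2 = 3 * L := by
    rw [div_pow, hb2]
    field_simp
  -- The 180 in `scoreConst` is 5·4·3·3: the target exponent, the tail bound, the 3 in b² and the 3
  -- in Q.
  have hexp2 : g ^ 2 / (4 * ((1 + C₀) / ι₁ * (Cσ + 1) * b ^ 2 * Q)) = 5 * L := by
    rw [hg, mul_pow, mul_pow, inv_pow, Real.sq_sqrt hnh0.le, scoreConst,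
      Real.sq_sqrt (by positivity), hb2, hQ]
    have h1 : 1 + C₀ ≠ 0 := by positivity
    have h2 : Cσ + 1 ≠ 0 := by positivity
    field_simp
    norm_num
  have hae : ∀ᵐ ω ∂P, ∀ t : ℕ, t ∈ Finset.Icc 1 n →
      X t ω = Matrix.mulVec (A (scaledTime n t)) (X ((t : ℤ) - 1) ω) + innovation n Sig ε t ω ∧
      ∀ j, adaptedState n A Sig ε ((t : ℤ) - 1) j ω = X ((t : ℤ) - 1) ω j := by
    rw [ae_all_iff]
    intro t
    by_cases ht : t ∈ Finset.Icc 1 n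
    · have ht' := Finset.mem_Icc.1 ht
      filter_upwards [hM.recursion t (by omega) (by omega),
        adaptedState_ae_eq hM (t := (t : ℤ) - 1) (by omega) (by omega)] with ω h1 h2 _
      exact ⟨h1, h2⟩
    · exact Eventually.of_forall fun ω h => absurd h ht
  have hsub : {ω | ¬ GoodPath n A Sig ε X K h b g ω} ⊆
      {ω | ¬ ∀ t : ℕ, t ∈ Finset.Icc 1 n →
        X t ω = Matrix.mulVec (A (scaledTime n t)) (X ((t : ℤ) - 1) ω) +
          innovation n Sig ε t ω ∧
        ∀ j, adaptedState n A Sig ε ((t : ℤ) - 1) j ω = X ((t : ℤ) - 1) ω j} ∪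
      ((⋃ t ∈ Finset.Icc 1 n, ⋃ j ∈ (Finset.univ : Finset (Fin d)),
          {ω | b < |X ((t : ℤ) - 1) ω j|}) ∪
        ⋃ m ∈ Finset.Icc 1 n, ⋃ k ∈ Finset.range 2, ⋃ i ∈ (Finset.univ : Finset (Fin d)),
          ⋃ j ∈ (Finset.univ : Finset (Fin d)),
            {ω | g < |truncScore n A Sig ε b (locWeight n K h (scaledTime n m) k) i j ω|}) := by
    intro ω hω
    by_contra hcon
    simp only [Set.mem_union, Set.mem_iUnion, Set.mem_ofPred_eq, not_or, not_exists, not_not,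
      not_lt] at hcon
    obtain ⟨h1, h2, h3⟩ := hcon
    have h2' : ∀ t : ℕ, t ∈ Finset.Icc 1 n → ∀ j, |X ((t : ℤ) - 1) ω j| ≤ b :=
      fun t ht j => h2 t ht j (Finset.mem_univ j)
    refine hω ⟨fun t ht => (h1 t ht).1, h2', fun m hm k hk i j => ?_⟩
    rw [← truncScore_eq (fun t ht => (h1 t ht).2 j) (fun t ht => h2' t ht j)]
    exact h3 m hm k (Finset.mem_range.2 (by omega)) i (Finset.mem_univ i) j (Finset.mem_univ j)
  have hstate : P (⋃ t ∈ Finset.Icc 1 n, ⋃ j ∈ (Finset.univ : Finset (Fin d)),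
      {ω | b < |X ((t : ℤ) - 1) ω j|}) ≤
      ENNReal.ofReal (n * (d * (C₀ * Real.exp (-(3 * L))))) := by
    calc _ ≤ ∑ t ∈ Finset.Icc 1 n, ∑ j : Fin d, ENNReal.ofReal (C₀ * Real.exp (-(3 * L))) := by
          refine (measure_biUnion_finset_le _ _).trans (Finset.sum_le_sum fun t ht => ?_)
          refine (measure_biUnion_finset_le _ _).trans (Finset.sum_le_sum fun j _ => ?_)
          have ht' := Finset.mem_Icc.1 ht
          rw [← hexp1]
          exact measure_state_le hM hC hρ₀ hρ₁ hι (by omega) (by omega) (by omega) j hb0.le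
      _ = _ := by
          simp only [Finset.sum_const, Nat.card_Icc, Finset.card_univ, Fintype.card_fin,
            add_tsub_cancel_right, nsmul_eq_mul]
          rw [ENNReal.ofReal_mul (Nat.cast_nonneg n), ENNReal.ofReal_mul (Nat.cast_nonneg d),
            ENNReal.ofReal_natCast, ENNReal.ofReal_natCast]
  have hscore : P (⋃ m ∈ Finset.Icc 1 n, ⋃ k ∈ Finset.range 2,
      ⋃ i ∈ (Finset.univ : Finset (Fin d)), ⋃ j ∈ (Finset.univ : Finset (Fin d)),
        {ω | g < |truncScore n A Sig ε b (locWeight n K h (scaledTime n m) k) i j ω|}) ≤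
      ENNReal.ofReal (n * (2 * (d * (d * (2 * Real.exp (-(5 * L))))))) := by
    calc _ ≤ ∑ m ∈ Finset.Icc 1 n, ∑ k ∈ Finset.range 2, ∑ i : Fin d, ∑ j : Fin d,
            ENNReal.ofReal (2 * Real.exp (-(5 * L))) := by
          refine (measure_biUnion_finset_le _ _).trans (Finset.sum_le_sum fun m hm => ?_)
          refine (measure_biUnion_finset_le _ _).trans (Finset.sum_le_sum fun k _ => ?_)
          refine (measure_biUnion_finset_le _ _).trans (Finset.sum_le_sum fun i _ => ?_)
          refine (measure_biUnion_finset_le _ _).trans (Finset.sum_le_sum fun j _ => ?_)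
          rw [← hexp2]
          exact measure_truncScore_le hM hC hι hb0 hg0 hQ0
            (sum_locWeight_pow_le hK hB hh hnh m k two_ne_zero) i j
      _ = _ := by
          simp only [Finset.sum_const, Nat.card_Icc, Finset.card_univ, Fintype.card_fin,
            add_tsub_cancel_right, nsmul_eq_mul, Finset.card_range]
          generalize 2 * Real.exp (-(5 * L)) = y
          rw [ENNReal.ofReal_mul (Nat.cast_nonneg n), ENNReal.ofReal_mul zero_le_two,
            ENNReal.ofReal_mul (Nat.cast_nonneg d), ENNReal.ofReal_mul (Nat.cast_nonneg d),
            ENNReal.ofReal_natCast, ENNReal.ofReal_natCast]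
          simp
  calc _ ≤ _ := measure_mono hsub
    _ ≤ 0 + (ENNReal.ofReal (n * (d * (C₀ * Real.exp (-(3 * L))))) +
        ENNReal.ofReal (n * (2 * (d * (d * (2 * Real.exp (-(5 * L)))))))) := by
      refine (measure_union_le _ _).trans (add_le_add (le_of_eq ?_) ?_)
      · exact ae_iff.1 hae
      · exact (measure_union_le _ _).trans (add_le_add hstate hscore)
    _ = ENNReal.ofReal (n * (d * (C₀ * Real.exp (-(3 * L)))) +
        n * (2 * (d * (d * (2 * Real.exp (-(5 * L))))))) := by
      rw [zero_add, ENNReal.ofReal_add (by positivity) (by positivity)]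
    _ ≤ _ := ENNReal.ofReal_le_ofReal (sum_tail_le (by omega) d (by linarith))

/-- On the good event the LASSO estimates are uniformly close to the true coefficients. -/
theorem GoodPath.estimate_le {ω : Ω} {K : ℝ → ℝ} {B h lam κ : ℝ}
    (hC : ModelConditions P n A Sig ε C₁ ρ D Cσ ι₁ C₀) (hι : 0 < ι₁)
    (hn : 2 ≤ n) (hK : IsKernel K) (hB : ∀ x, K x ≤ B)
    (hh : 0 < h) (hnh : 1 ≤ n * h) (hκ : 0 < κ) (hlam : 0 < lam) (hL : 1 ≤ logMax n d)
    (hs : 1 ≤ sparsity n A)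
    (hgood : GoodPath n A Sig ε X K h (stateBound n d C₁ ρ Cσ ι₁)
      (scoreConst C₁ ρ Cσ ι₁ C₀ B * (logMax n d * (Real.sqrt (n * h))⁻¹)) ω)
    (hRE : RestrictedEigenvalue n A K h κ fun t => X t ω)
    (hzeta : 8 * (scoreConst C₁ ρ Cσ ι₁ C₀ B + 36 * B * |D| * stateScale C₁ ρ Cσ ^ 2 / ι₁ +
      3 * |D| + 1) * zeta n d (sparsity n A) h ≤ lam)
    {i : Fin d} {m : ℕ} (hm : m ∈ Finset.Icc 1 n) {α β : Fin d → ℝ}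
    (hest : IsLassoEstimate n K h lam (fun t => X t ω) i (scaledTime n m) α β) :
    l2Norm (α - coef A i (scaledTime n m)) + h * l2Norm (β - coefDeriv A i (scaledTime n m)) ≤
      2 * (1 + 4 / κ) * (Real.sqrt (sparsity n A) * lam) := by
  have hD0 : 0 ≤ D := (abs_nonneg _).trans (hC.second_deriv_bound i i 0 (by simp))
  have hB0 : 0 ≤ B := (hK.nonneg 0).trans (hB 0)
  have hs1 : (1 : ℝ) ≤ sparsity n A := by exact_mod_cast hs
  rw [abs_of_nonneg hD0] at hzeta
  set L := logMax n d with hLdef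
  set G := scoreConst C₁ ρ Cσ ι₁ C₀ B with hG
  have hG0 : 0 ≤ G := Real.sqrt_nonneg _
  set R := 36 * B * D * stateScale C₁ ρ Cσ ^ 2 / ι₁ with hR
  have hR0 : 0 ≤ R := by positivity
  set z₁ := L * (Real.sqrt (n * h))⁻¹ with hz₁
  set z₂ := L * (sparsity n A * h ^ 2) with hz₂
  have hz : zeta n d (sparsity n A) h = z₁ + z₂ := by rw [zeta, mul_add]
  have hz₁0 : 0 ≤ z₁ := by positivity
  have hz₂0 : 0 ≤ z₂ := by positivity
  rw [hz] at hzeta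
  -- The squared state bound supplies both the factor log(n ∨ d) in the bias part of ζ and the 3
  -- that turns 12 into 36.
  have hbias : 12 * B * D * stateBound n d C₁ ρ Cσ ι₁ ^ 2 * (sparsity n A * h ^ 2) = R * z₂ := by
    rw [stateBound, mul_pow, Real.sq_sqrt (by positivity), hR, hz₂]
    ring
  have hh2 : h ^ 2 ≤ z₂ := by
    have h1 : h ^ 2 ≤ sparsity n A * h ^ 2 := le_mul_of_one_le_left (by positivity) hs1
    exact h1.trans (le_mul_of_one_le_left (by positivity) hL)
  have hp := mul_nonneg hG0 hz₁0
  have hp2 := mul_nonneg hG0 hz₂0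
  have hp3 := mul_nonneg hR0 hz₁0
  have hp4 := mul_nonneg hR0 hz₂0
  have hp5 := mul_nonneg hD0 hz₁0
  have hp6 := mul_nonneg hD0 hz₂0
  have key := lasso_path_bound (x := fun t => X t ω) (i := i) (s := sparsity n A)
    (g := G * z₁) (b := stateBound n d C₁ ρ Cσ ι₁)
    (hC.smooth_transition i) (hC.second_deriv_bound i) hn hK hB hh hnh hκ hlam hm
    (hRE i m hm) hs (Finset.le_sup (f := fun i => (gridSupport n A i).card) (Finset.mem_univ i))
    (fun t => innovation n Sig ε t ω i)
    (fun t ht => congrFun (hgood.recursion t ht) i) hgood.state_le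
    (fun k hk j => hgood.score_le m hm k hk i j)
    (by rw [hbias]; linarith)
    (by nlinarith [mul_le_mul_of_nonneg_left hh2 hD0]) hest
  linarith

end GoodPath

/-! ### Rates -/

theorem tendsto_logMax (d : ℕ → ℕ) : Tendsto (fun n => logMax n (d n)) atTop atTop := by
  refine tendsto_atTop_mono' _ ?_ (Real.tendsto_log_atTop.comp tendsto_natCast_atTop_atTop)
  filter_upwards [eventually_gt_atTop 0] with n hn
  exact Real.log_le_log (by exact_mod_cast hn) (le_max_left _ _)

theorem isBigOP_of_measure_tendsto_zero {Ω : Type*} [MeasurableSpace Ω] {P : Measure Ω}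
    {Y : ℕ → Ω → ℝ} {r : ℕ → ℝ} {M : ℝ} {bad : ℕ → Set Ω}
    (hbad : Tendsto (fun n => P (bad n)) atTop (𝓝 0))
    (h : ∀ᶠ n in atTop, ∀ ω ∉ bad n, |Y n ω| ≤ M * r n) : IsBigOP P Y r := by
  intro η hη
  have h1 := hbad.eventually (ge_mem_nhds (ENNReal.ofReal_pos.2 hη))
  obtain ⟨N, hN⟩ := eventually_atTop.1 (h1.and h)
  refine ⟨M, N, fun n hn => (measure_mono fun ω hω => ?_).trans (hN n hn).1⟩
  by_contra hcon
  exact absurd ((hN n hn).2 ω hcon) (not_le.2 hω)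

end TVVAR

/-! ### Assembly of the uniform rate -/

open TVVAR in
theorem theorem4p1
    {Ω : Type*} [MeasurableSpace Ω] (P : Measure Ω) [IsProbabilityMeasure P]
    -- dimension, transition matrices, volatility matrices, noise and observed process,
    -- for each sample size `n`
    (d : ℕ → ℕ)
    (A Sig : (n : ℕ) → ℝ → Matrix (Fin (d n)) (Fin (d n)) ℝ)
    (ε X : (n : ℕ) → ℤ → Ω → Fin (d n) → ℝ)
    -- constants that do not depend on `n`
    (C₁ ρ D Cσ ι₁ C₀ κ₀ : ℝ) (hρ₀ : 0 < ρ) (hρ₁ : ρ < 1) (hι₁ : 0 < ι₁) (hκ₀ : 0 < κ₀)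
    (hmodel : ∀ n, 1 ≤ n → IsModel P n (A n) (Sig n) (ε n) (X n))
    (hcond : ∀ n, 1 ≤ n → ModelConditions P n (A n) (Sig n) (ε n) C₁ ρ D Cσ ι₁ C₀)
    -- kernel, bandwidth and tuning parameter
    (K : ℝ → ℝ) (hK : IsKernel K)
    (h lam₁ : ℕ → ℝ) (hh : ∀ n, 0 < h n) (hlam₁ : ∀ n, 0 < lam₁ n)
    (s : ℕ → ℕ) (hs : ∀ n, s n = sparsity n (A n)) (hs_pos : ∀ᶠ n in atTop, 1 ≤ s n)
    (hband₁ : Tendsto (fun n : ℕ => n * h n / logMax n (d n) ^ 2) atTop atTop)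
    (hband₂ : Tendsto (fun n : ℕ => s n * h n ^ 2 * logMax n (d n)) atTop (𝓝 0))
    (htune₁ : (fun n : ℕ => zeta n (d n) (s n) (h n)) =o[atTop] lam₁)
    (htune₂ : Tendsto (fun n : ℕ => Real.sqrt (s n) * lam₁ n / h n) atTop (𝓝 0))
    -- the restricted eigenvalue condition holds with probability approaching one
    (hRE : Tendsto
      (fun n : ℕ => P {ω | ¬ RestrictedEigenvalue n (A n) K (h n) κ₀ (fun t => X n t ω)})
      atTop (𝓝 0))
    -- the preliminary time-varying LASSO estimates at the scaled time points
    (αest βest : (n : ℕ) → Fin (d n) → ℕ → Ω → Fin (d n) → ℝ)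
    (hest : ∀ n, ∀ ω, ∀ i, ∀ t ∈ Finset.Icc 1 n,
      IsLassoEstimate n K (h n) (lam₁ n) (fun t => X n t ω) i (scaledTime n t)
        (αest n i t ω) (βest n i t ω)) :
    IsBigOP P
      (fun n ω => ⨆ i : Fin (d n), ⨆ t : Finset.Icc 1 n,
        l2Norm (αest n i t ω - coef (A n) i (scaledTime n (t : ℕ))))
      (fun n => Real.sqrt (s n) * lam₁ n) ∧
    IsBigOP P
      (fun n ω => ⨆ i : Fin (d n), ⨆ t : Finset.Icc 1 n,
        (l2Norm (αest n i t ω - coef (A n) i (scaledTime n (t : ℕ))) +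
          h n * l2Norm (βest n i t ω - coefDeriv (A n) i (scaledTime n (t : ℕ)))))
      (fun n => Real.sqrt (s n) * lam₁ n) ∧
    Tendsto (fun n => Real.sqrt (s n) * lam₁ n) atTop (𝓝 0) := by
  obtain ⟨B, hB⟩ : ∃ B, 0 < B ∧ ∀ x, K x ≤ B := by
    obtain ⟨B, hB⟩ := hK.bounded
    exact ⟨max B 1, lt_max_of_lt_right one_pos, fun x => (hB x).trans (le_max_left _ _)⟩
  obtain ⟨hB0, hB⟩ := hB
  have hL1 : ∀ᶠ n in atTop, 1 ≤ logMax n (d n) := (tendsto_logMax d).eventually_ge_atTop 1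
  have hnh : ∀ᶠ n : ℕ in atTop, 1 ≤ n * h n := by
    filter_upwards [hband₁.eventually_ge_atTop 1, hL1] with n h1 h2
    rw [le_div_iff₀ (by positivity), one_mul] at h1
    exact (one_le_pow₀ h2).trans h1
  have hd : ∀ᶠ n in atTop, 0 < d n := by
    filter_upwards [hs_pos] with n h1
    rw [hs] at h1
    by_contra h0
    have h0 : d n = 0 := by omega
    have : IsEmpty (Fin (d n)) := by rw [h0]; infer_instance
    simp [sparsity] at h1
  -- The absolute value is used because D ≥ 0 is only deduced from the second derivative bound once
  -- a row index is given.
  set G : ℝ := scoreConst C₁ ρ Cσ ι₁ C₀ B + 36 * B * |D| * stateScale C₁ ρ Cσ ^ 2 / ι₁ +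
      3 * |D| + 1 with hG
  have hG0 : 0 < G := by
    have : 0 ≤ scoreConst C₁ ρ Cσ ι₁ C₀ B := Real.sqrt_nonneg _
    positivity
  have hzeta : ∀ᶠ n in atTop, 8 * G * zeta n (d n) (sparsity n (A n)) (h n) ≤ lam₁ n := by
    filter_upwards [htune₁.bound (by positivity : 0 < (8 * G)⁻¹)] with n hn
    rw [Real.norm_eq_abs, Real.norm_eq_abs, abs_of_pos (hlam₁ n), hs,
      ← div_eq_inv_mul, le_div_iff₀ (by positivity)] at hn
    calc _ ≤ |zeta n (d n) (sparsity n (A n)) (h n)| * (8 * G) := by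
          rw [mul_comm]
          gcongr
          exact le_abs_self _
      _ ≤ _ := hn
  set good : ℕ → Set Ω := fun n => {ω | GoodPath n (A n) (Sig n) (ε n) (X n) K (h n)
    (stateBound n (d n) C₁ ρ Cσ ι₁)
    (scoreConst C₁ ρ Cσ ι₁ C₀ B * (logMax n (d n) * (Real.sqrt (n * h n))⁻¹)) ω} with hgood
  set bad : ℕ → Set Ω := fun n =>
    {ω | ¬ RestrictedEigenvalue n (A n) K (h n) κ₀ (fun t => X n t ω)} ∪ (good n)ᶜ with hbaddef
  have hgoodlim : Tendsto (fun n => P (good n)ᶜ) atTop (𝓝 0) := by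
    have h1 : Tendsto (fun n : ℕ => ENNReal.ofReal ((C₀ + 4) / n)) atTop (𝓝 0) := by
      simpa using ENNReal.tendsto_ofReal (tendsto_const_div_atTop_nhds_zero_nat (C₀ + 4))
    refine tendsto_of_tendsto_of_tendsto_of_le_of_le' tendsto_const_nhds h1
      (Eventually.of_forall fun _ => zero_le) ?_
    filter_upwards [eventually_ge_atTop 2, hd, hnh] with n hn hdn hnhn
    exact measure_not_goodPath_le (hmodel n (by omega)) (hcond n (by omega)) hρ₀ hρ₁ hι₁ hn hdn
      hK hB hB0 (hh n) hnhn
  have hbad : Tendsto (fun n => P (bad n)) atTop (𝓝 0) := by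
    have h1 := hRE.add hgoodlim
    rw [add_zero] at h1
    exact tendsto_of_tendsto_of_tendsto_of_le_of_le tendsto_const_nhds h1 (fun _ => zero_le)
      fun n => measure_union_le _ _
  have hbound : ∀ᶠ n in atTop, ∀ ω ∉ bad n, ∀ (i : Fin (d n)) (t : Finset.Icc 1 n),
      l2Norm (αest n i t ω - coef (A n) i (scaledTime n (t : ℕ))) +
        h n * l2Norm (βest n i t ω - coefDeriv (A n) i (scaledTime n (t : ℕ))) ≤
      2 * (1 + 4 / κ₀) * (Real.sqrt (s n) * lam₁ n) := by
    filter_upwards [eventually_ge_atTop 2, hs_pos, hL1, hnh, hzeta] with n hn hsn hLn hnhn hzn ω hω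
      i t
    simp only [hbaddef, hgood, Set.mem_union, Set.mem_compl_iff, Set.mem_ofPred_eq, not_or,
      not_not] at hω
    rw [hs] at hsn ⊢
    exact hω.2.estimate_le (hcond n (by omega)) hι₁ hn hK hB (hh n) hnhn hκ₀ (hlam₁ n) hLn hsn
      hω.1 hzn t.2 (hest n ω i t t.2)
  have hr : ∀ n, 0 ≤ 2 * (1 + 4 / κ₀) * (Real.sqrt (s n) * lam₁ n) := fun n => by
    have := hlam₁ n
    positivity
  have hl2 : ∀ {k : ℕ} (v : Fin k → ℝ), 0 ≤ l2Norm v := fun v => norm_nonneg _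
  refine ⟨isBigOP_of_measure_tendsto_zero (M := 2 * (1 + 4 / κ₀)) hbad ?_,
    isBigOP_of_measure_tendsto_zero (M := 2 * (1 + 4 / κ₀)) hbad ?_, ?_⟩
  · filter_upwards [hbound] with n hn ω hω
    rw [abs_of_nonneg (Real.iSup_nonneg fun i => Real.iSup_nonneg fun t => hl2 _)]
    -- Nonnegativity of the bound covers empty index types, where the real supremum is 0.
    refine Real.iSup_le (fun i => Real.iSup_le (fun t => ?_) (hr n)) (hr n)
    have := mul_nonneg (hh n).le
      (hl2 (βest n i t ω - coefDeriv (A n) i (scaledTime n (t : ℕ))))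
    linarith [hn ω hω i t]
  · filter_upwards [hbound] with n hn ω hω
    rw [abs_of_nonneg (Real.iSup_nonneg fun i => Real.iSup_nonneg fun t =>
      add_nonneg (hl2 _) (mul_nonneg (hh n).le (hl2 _)))]
    exact Real.iSup_le (fun i => Real.iSup_le (fun t => hn ω hω i t) (hr n)) (hr n)
  -- Since h² ≤ s h² log(n ∨ d) eventually, h → 0; multiplying √s λ₁/h → 0 by h gives consistency.
  · have hh2 : Tendsto (fun n => h n ^ 2) atTop (𝓝 0) := by
      refine tendsto_of_tendsto_of_tendsto_of_le_of_le' tendsto_const_nhds hband₂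
        (Eventually.of_forall fun n => sq_nonneg _) ?_
      filter_upwards [hs_pos, hL1] with n h1 h2
      have h1 : (1 : ℝ) ≤ s n := by exact_mod_cast h1
      calc h n ^ 2 ≤ s n * h n ^ 2 := le_mul_of_one_le_left (sq_nonneg _) h1
        _ ≤ _ := le_mul_of_one_le_right (by positivity) h2
    have hh0 : Tendsto h atTop (𝓝 0) := by
      have h1 := hh2.sqrt
      simpa only [Real.sqrt_sq (hh _).le, Real.sqrt_zero] using h1
    have h1 := htune₂.mul hh0
    rw [mul_zero] at h1
    refine h1.congr fun n => ?_
    have := (hh n).ne'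
    field_simp
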